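/- **Readers/writers lock: types of prologue and epilogue, with the proof outline of prologue.** *Framework.* A state is a triple (self, joint, other), where self and other are drawn from a partial commutative monoid (PCM) and describe the invoking thread and its environment. A state space is a set $S$ of states together with a flattening to heaps; both are global (independent of whether a PCM element is framed onto self or onto other), self and other are compatible in the states of $S$, and the flattening of a state of $S$ is a defined heap. A transition is a relation on states that is functional, does not change other, is local (if it can be taken from $s$ with $p$ framed onto other, it can be taken from $s$ with $p$ framed onto self, with correspondingly framed results), and preserves $S$. A resource is a state space with a set of internal transitions, which preserve the domain of the flattened heap, and a set of external ones; restricting an internal transition by a guard that leaves it a transition gives an internal transition again, and so does idling. An other-step is any transition taken with self and other exchanged. Two transitions of component resources are coupled by taking both at once in a product of state spaces, in which the flattened heaps of the components are disjoint. For a global predicate $I$ preserved by the internal transitions of $V$, the restriction $V/I$ has the states of $V$ that satisfy $I$. An atomic action is a family, indexed by its return value, of internal transitions, of which at most one is enabled in each state. A morphism $f:V\to W$ relates the states of $V$ and $W$ and maps internal transitions of $V$ to internal transitions of $W$, such that $W$ simulates the internal transitions of $V$, $V$ simulates the other-steps of $W$, the state of $V$ is a function of that of $W$, and framing is respected. If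 $e$ is a program over $V$, $\mathsf{morph}\,f\,e$ is the program over $W$ that executes $f(t)$ whenever $e$ executes $t$. Programs are sets of finite action trees approximating their behaviours; recursion is by least fixed points. A program $e$ has the type $[\Gamma].\{P\}\,A\,\{Q\}@V$ if for each value of the logical variables $\Gamma$ and each $s\in S(V)$ with $P(s)$, under arbitrary interleaving with other-steps of $V$, $e$ never reaches an action that is not enabled, and whenever $e$ returns a value $v\in A$, the state satisfies $Q\,v$, then and after any further other-steps (partial correctness). *Components.* Let $O=\{\mathsf{own},\overline{\mathsf{own}}\}$ be the PCM with unit $\overline{\mathsf{own}}$ in which $\mathsf{own}+\mathsf{own}$ is undefined. $S$ is the state space, $\lfloor s\rfloor$ the flattened heap, $r\mapsto v$ the heap with the one pointer $r$. All transitions below require both states to be in $S$, and do not change other. * $\mathsf{Spin}'(r)$: states $(\mu_s,(\lambda,\pi),\mu_o)$, $\mu_s,\mu_o\in O$, $\lambda,\pi$ booleans, $\mu=\mu_s+\mu_o$. $S$: $\mu$ defined, $r\ne\mathsf{null}$, $\neg\lambda\to\mu=\overline{\mathsf{own}}\wedge\pi$; $\lfloor s\rfloor=r\mapsto\lambda$.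 For $x\in O$, from $s$ to $s'$: $\mathsf{lock\_tr}\,x$: $\neg\lambda$, $\lambda'$, $\mu_s'=x$, $\pi'$. $\mathsf{unlock\_tr}\,x$: $\lambda$, $\mu_s=x$, $\mu_o=\overline{\mathsf{own}}$, $\pi$, $\neg\lambda'$. $\mathsf{set\_tr}\,x\,b$: $\lambda$, $\mu_s=x$, $\mu_o=\overline{\mathsf{own}}$, $\lambda'$, $\mu_s'=x$, $\pi'=b$. Internal: $\mathsf{lock\_tr}$ and $\mathsf{unlock\_tr}$ for $x=\mathsf{own}$; external: these for $x=\overline{\mathsf{own}}$, and $\mathsf{set\_tr}$. * $\mathsf{Shar}$: a joint heap $\sigma_j$ and a boolean $\nu$. $S$: $\sigma_j$ is defined, and $I(\sigma_j)$ if $\nu$, $\sigma_j=\mathsf{empty}$ if not, where $I$ is a given predicate on heaps; $\lfloor s\rfloor=\sigma_j$. $\mathsf{take\_tr}\,h$: $I(h)$, $\neg\nu$, $\sigma_j'=h$, $\nu'$. $\mathsf{give\_tr}\,h$: $h=\sigma_j$, $\nu$, $\sigma_j'=\mathsf{empty}$, $\neg\nu'$. * $\mathsf{Priv}$: private heaps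 $\sigma_s,\sigma_o$. $S$: $\sigma_s+\sigma_o$ (disjoint union) defined; $\lfloor s\rfloor=\sigma_s+\sigma_o$. $\mathsf{take\_tr}\,h$: $\sigma_s'=h+\sigma_s$. $\mathsf{give\_tr}\,h$: $\sigma_s=h+\sigma_s'$. Also mutation of a pointer of $\sigma_s$. * $\mathsf{Count}$: $(\kappa_s,\iota,\kappa_o)$ with $\kappa_s,\kappa_o\in\mathbb N$, $\iota$ a boolean, $\kappa=\kappa_s+\kappa_o$. $S$: $\mathsf{ct}\ne\mathsf{null}$, $\kappa>0\to\iota$; $\lfloor s\rfloor=\mathsf{ct}\mapsto\kappa$. $\mathsf{incr\_tr}$: $\iota$, $\kappa_s'=\kappa_s+1$. $\mathsf{decr\_tr}$: $\kappa_s'+1=\kappa_s$, $\iota'$. $\mathsf{set\_tr}\,b$: $\kappa=\kappa'=0$, $\iota'=b$. *The resource.* $\mathsf{RWLock}'$ has the product of the state spaces of $\mathsf{Spin}'(wr)$, $\mathsf{Shar}$, $\mathsf{Priv}$, $\mathsf{Spin}'(rd)$, $\mathsf{Count}$, $\mathsf{Shar}$ (fields of the second copies have the subscript 2) and the following couplings,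 all internal, where components not listed idle: $\mathsf{wrlock\_tr}$, $\mathsf{wrunlock\_tr}$ ($\mathsf{lock\_tr}\,\mathsf{own}$, $\mathsf{unlock\_tr}\,\mathsf{own}$ of $wr$); $\mathsf{rdlock\_tr}$, $\mathsf{rdunlock\_tr}$ (the same of $rd$); $\mathsf{freeze\_tr}$, $\mathsf{unfreeze\_tr}$ ($\mathsf{lock\_tr}\,\overline{\mathsf{own}}$, $\mathsf{unlock\_tr}\,\overline{\mathsf{own}}$ of $wr$, if $\mu_{s2}=\mathsf{own}$); $\mathsf{incr\_tr}$, $\mathsf{decr\_tr}$ (those of $\mathsf{Count}$, if $\mu_{s2}=\mathsf{own}$); $\mathsf{open\_tr}$ ($\mathsf{set\_tr}\,\mathsf{own}\,\mathsf{false}$ of $wr$, $\mathsf{give\_tr}\,h$ of $\mathsf{Shar}$, $\mathsf{take\_tr}\,h$ of $\mathsf{Priv}$); $\mathsf{close\_tr}$ ($\mathsf{set\_tr}\,\mathsf{own}\,\mathsf{true}$, $\mathsf{take\_tr}\,h$, $\mathsf{give\_tr}\,h$ of the same); $\mathsf{toreader\_tr}$ ($\mathsf{set\_tr}\,\overline{\mathsf{own}}\,\mathsf{false}$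 of $wr$, $\mathsf{give\_tr}\,h$ of $\mathsf{Shar}$, $\mathsf{set\_tr}\,\mathsf{true}$ of $\mathsf{Count}$, $\mathsf{take\_tr}\,h$ of the second $\mathsf{Shar}$, if $\mu_{s2}=\mathsf{own}$); $\mathsf{towriter\_tr}$ ($\mathsf{set\_tr}\,\overline{\mathsf{own}}\,\mathsf{true}$, $\mathsf{take\_tr}\,h$, $\mathsf{set\_tr}\,\mathsf{false}$, $\mathsf{give\_tr}\,h$ of the same, if $\mu_{s2}=\mathsf{own}$); mutation of a private heap; idling. Then $\mathsf{RWLock}=\mathsf{RWLock}'/\mathsf{RWinv}$, where $\mathsf{RWinv}$ is $$\pi=\nu\ \wedge\ \iota=\nu_2\ \wedge\ \pi_2\ \wedge\ (\lambda_2\to\mu_2=\mathsf{own})\ \wedge\ (\nu_2\leftrightarrow\lambda\wedge\mu=\overline{\mathsf{own}}\wedge\neg\nu).$$ *The programs.* Over $\mathsf{Spin}'(rd)$, $\mathsf{lock}$ repeats an attempt to take $\mathsf{lock\_tr}\,\mathsf{own}$ until it succeeds; a failed attempt idles in a state with $\lambda$. $\mathsf{rdlock}=\mathsf{morph}\,g\,(\mathsf{morph}\,f\,\mathsf{lock})$,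 where $f:\mathsf{Spin}'(rd)\to\mathsf{RWLock}'$ relates a state to its $\mathsf{Spin}'(rd)$ component and maps a transition to its coupling with idling elsewhere, and $g:\mathsf{RWLock}'\to\mathsf{RWLock}$ is the identity. $\mathsf{freeze}$ is the analogous loop over $\mathsf{freeze\_tr}$. The action $\mathsf{readcnt\_act}$ idles and returns $\kappa$; $\mathsf{incr\_act}\,x$ and $\mathsf{decr\_act}\,x$ take $\mathsf{incr\_tr}$ and $\mathsf{decr\_tr}$ if $\kappa=x$; $\mathsf{toreader\_act}$, $\mathsf{towriter\_act}$, $\mathsf{unfreeze\_act}$, $\mathsf{rdunlock\_act}$ take the transitions of the same names. $$\mathsf{prologue}=\mathsf{rdlock};\ x\leftarrow\mathsf{readcnt\_act};\ (\mathsf{if}\ x=0\ \mathsf{then}\ \mathsf{freeze};\mathsf{toreader\_act});\ \mathsf{incr\_act}\,x;\ \mathsf{rdunlock\_act}$$ $$\mathsf{epilogue}=\mathsf{rdlock};\ x\leftarrow\mathsf{readcnt\_act};\ \mathsf{decr\_act}\,x;\ (\mathsf{if}\ x=1\ \mathsf{then}\ \mathsf{towriter\_act};\mathsf{unfreeze\_act});\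 \mathsf{rdunlock\_act}$$ **Claim.** For all pointers $wr,rd,\mathsf{ct}$ and every predicate $I$ on heaps: 1. $\mathsf{prologue}:[h,c].\{\sigma_s=h\wedge\kappa_s=c\}\{\sigma_s=h\wedge\kappa_s=c+1\}@\mathsf{RWLock}$. 2. $\mathsf{epilogue}:[h,c].\{\sigma_s=h\wedge\kappa_s=c+1\}\{\sigma_s=h\wedge\kappa_s=c\}@\mathsf{RWLock}$. 3. The steps of $\mathsf{prologue}$ have the following types over $\mathsf{RWLock}$, for all $h,c$ and, in (c) and (d), all $x\in\mathbb N$: (a) $\mathsf{rdlock}:\{\sigma_s=h\wedge\kappa_s=c\}\{\sigma_s=h\wedge\kappa_s=c\wedge\mu_{s2}=\mathsf{own}\}$; (b) $\mathsf{readcnt\_act}$, with result $x$: $\{\sigma_s=h\wedge\kappa_s=c\wedge\mu_{s2}=\mathsf{own}\}\{\sigma_s=h\wedge\kappa_s=c\wedge\mu_{s2}=\mathsf{own}\wedge x=c+\kappa_o\}$; (c) the conditional: $\{\sigma_s=h\wedge\kappa_s=c\wedge\mu_{s2}=\mathsf{own}\wedge x=c+\kappa_o\}\{\sigma_s=h\wedge\kappa_s=c\wedge\mu_{s2}=\mathsf{own}\wedge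 x=c+\kappa_o\wedge\iota\}$; (d) $\mathsf{incr\_act}\,x:\{\sigma_s=h\wedge\kappa_s=c\wedge\mu_{s2}=\mathsf{own}\wedge x=c+\kappa_o\wedge\iota\}\{\sigma_s=h\wedge\kappa_s=c+1\wedge\mu_{s2}=\mathsf{own}\}$; (e) $\mathsf{rdunlock\_act}:\{\sigma_s=h\wedge\kappa_s=c+1\wedge\mu_{s2}=\mathsf{own}\}\{\sigma_s=h\wedge\kappa_s=c+1\}$. 4. $\mathsf{rdlock}$ is the lifting $\mathsf{morph}\,g\,(\mathsf{morph}\,f\,\mathsf{lock})$ of $\mathsf{lock}$ along $f$ and $g$, where $\mathsf{lock}:\{\top\}\{\mu_s=\mathsf{own}\wedge\pi\}@\mathsf{Spin}'(rd)$. -/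

import Mathlib

namespace FCSL

/-! ## Partial commutative monoids, heaps, states -/

/-- A partial commutative monoid, presented as a commutative monoid whose operation is total, together
with the predicate `defined`; the elements that are not `defined` stand for "undefined". -/
class PCM (U : Type) extends AddCommMonoid U where
  defined : U → Prop
  defined_zero : defined 0
  defined_left : ∀ a b : U, defined (a + b) → defined a

instance : PCM ℕ where
  defined _ := True
  defined_zero := trivial
  defined_left _ _ _ := trivial

instance : PCM Unit where
  defined _ := True
  defined_zero := trivial
  defined_left _ _ _ := trivial

instance {U₁ U₂ : Type} [PCM U₁] [PCM U₂] : PCM (U₁ × U₂) where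
  defined a := PCM.defined a.1 ∧ PCM.defined a.2
  defined_zero := ⟨PCM.defined_zero, PCM.defined_zero⟩
  defined_left a b h := ⟨PCM.defined_left a.1 b.1 h.1, PCM.defined_left a.2 b.2 h.2⟩

/-- Storable values: booleans, natural numbers (also used as pointers), and data of an arbitrary type. -/
inductive Val (D : Type) where
  | bool (b : Bool)
  | nat (n : ℕ)
  | data (d : D)

/-- Finite partial maps from pointers to values; the pointer `0` is null and is never allocated. -/
@[ext]
structure FinHeap (D : Type) where
  get : ℕ → Option (Val D)
  null : get 0 = none
  finite : {p | get p ≠ none}.Finite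

/-- Heaps under disjoint union, with `undef` for the undefined result. -/
inductive Heap (D : Type) where
  | undef
  | mk (m : FinHeap D)

namespace FinHeap

variable {D : Type}

def Disj (m₁ m₂ : FinHeap D) : Prop := ∀ p, m₁.get p = none ∨ m₂.get p = none

def union (m₁ m₂ : FinHeap D) : FinHeap D where
  get p := (m₁.get p).or (m₂.get p)
  null := by simp [m₁.null, m₂.null]
  finite := by
    refine (m₁.finite.union m₂.finite).subset ?_
    intro p hp
    simp only [Set.mem_ofPred_eq, ne_eq, Option.or_eq_none_iff, not_and_or] at hp
    exact hp

def empty : FinHeap D where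
  get _ := none
  null := rfl
  finite := by simp

def single (p : ℕ) (hp : p ≠ 0) (v : Val D) : FinHeap D where
  get q := if q = p then some v else none
  null := by simp [Ne.symm hp]
  finite := by
    refine (Set.finite_singleton p).subset ?_
    intro q hq
    by_contra h
    simp_all

end FinHeap

namespace Heap

variable {D : Type}

open Classical in
noncomputable def add : Heap D → Heap D → Heap D
  | mk m₁, mk m₂ => if m₁.Disj m₂ then mk (m₁.union m₂) else undef
  | _, _ => undef

/-- The singleton heap `p ↦ v`, undefined if `p` is null. -/
def pts (p : ℕ) (v : Val D) : Heap D :=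
  if hp : p ≠ 0 then mk (FinHeap.single p hp v) else undef

/-- The set of pointers of a heap. -/
def dom : Heap D → Set ℕ
  | undef => ∅
  | mk m => {p | m.get p ≠ none}

theorem add_undef (a : Heap D) : add a undef = undef := by cases a <;> rfl

theorem add_comm_aux (a b : Heap D) : add a b = add b a := by
  cases a with
  | undef => rw [add_undef]; rfl
  | mk m₁ =>
    cases b with
    | undef => rfl
    | mk m₂ =>
      have hd : m₁.Disj m₂ ↔ m₂.Disj m₁ := forall_congr' fun p => or_comm
      by_cases h : m₁.Disj m₂
      · have h2 := hd.1 h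
        simp only [add, if_pos h, if_pos h2]
        congr 1
        ext1
        funext p
        rcases h p with hp | hp <;> simp [FinHeap.union, hp]
      · have h2 : ¬ m₂.Disj m₁ := fun x => h (hd.2 x)
        simp only [add, if_neg h, if_neg h2]

theorem add_assoc_aux (a b c : Heap D) : add (add a b) c = add a (add b c) := by
  cases a with
  | undef => rfl
  | mk m₁ =>
    cases b with
    | undef => rfl
    | mk m₂ =>
      cases c with
      | undef => rw [add_undef, add_undef, add_undef]
      | mk m₃ =>
        have e1 : (m₁.union m₂).Disj m₃ ↔ m₁.Disj m₃ ∧ m₂.Disj m₃ := by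
          constructor
          · intro h
            constructor <;> intro p <;> have := h p <;>
              simp only [FinHeap.union, Option.or_eq_none_iff] at this <;> tauto
          · rintro ⟨h1, h2⟩ p
            have := h1 p
            have := h2 p
            simp only [FinHeap.union, Option.or_eq_none_iff]
            tauto
        have e2 : m₁.Disj (m₂.union m₃) ↔ m₁.Disj m₂ ∧ m₁.Disj m₃ := by
          constructor
          · intro h
            constructor <;> intro p <;> have := h p <;>
              simp only [FinHeap.union, Option.or_eq_none_iff] at this <;> tauto
          · rintro ⟨h1, h2⟩ p
            have := h1 p
            have := h2 p
            simp only [FinHeap.union, Option.or_eq_none_iff]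
            tauto
        have e3 : (m₁.union m₂).union m₃ = m₁.union (m₂.union m₃) := by
          ext1
          funext p
          simp [FinHeap.union, Option.or_assoc]
        by_cases h12 : m₁.Disj m₂ <;> by_cases h23 : m₂.Disj m₃ <;> by_cases h13 : m₁.Disj m₃ <;>
          simp [add, h12, h23, h13, e1, e2, e3]

noncomputable instance : Add (Heap D) := ⟨add⟩

instance : Zero (Heap D) := ⟨mk FinHeap.empty⟩

noncomputable instance : PCM (Heap D) where
  add_assoc := add_assoc_aux
  add_comm := add_comm_aux
  zero_add a := by
    change add (mk FinHeap.empty) a = a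
    cases a with
    | undef => rfl
    | mk m =>
      have h : FinHeap.empty.Disj m := fun p => Or.inl rfl
      simp only [add, if_pos h]
      congr 1
  add_zero a := by
    change add a (mk FinHeap.empty) = a
    rw [add_comm_aux]
    cases a with
    | undef => rfl
    | mk m =>
      have h : FinHeap.empty.Disj m := fun p => Or.inl rfl
      simp only [add, if_pos h]
      congr 1
  nsmul := nsmulRec
  defined h := h ≠ undef
  defined_zero := by intro h; cases h
  defined_left a b h := by
    rintro rfl
    exact h rfl

theorem cancel {a b c : Heap D} (hd : PCM.defined (a + b)) (h : a + b = a + c) : b = c := by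
  change add a b ≠ undef at hd
  change add a b = add a c at h
  cases a with
  | undef => exact absurd rfl hd
  | mk m₁ =>
    cases b with
    | undef => exact absurd rfl hd
    | mk m₂ =>
      cases c with
      | undef => rw [h] at hd; exact absurd rfl hd
      | mk m₃ =>
        by_cases h12 : m₁.Disj m₂
        · by_cases h13 : m₁.Disj m₃
          · simp only [add, if_pos h12, if_pos h13] at h
            congr 1
            ext1
            funext p
            have hp := congrArg (fun m => FinHeap.get m p) (Heap.mk.inj h)
            simp only [FinHeap.union] at hp
            rcases h12 p with q | q <;> rcases h13 p with r | r <;> simp_all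
          · simp [add, h12, h13] at h
        · simp [add, h12] at hd

theorem pts_defined {p : ℕ} (hp : p ≠ 0) (v : Val D) : PCM.defined (pts p v) := by
  change pts p v ≠ undef
  simp [pts, hp]

theorem dom_pts {p : ℕ} (hp : p ≠ 0) (v : Val D) : dom (pts p v) = {p} := by
  ext q
  simp [pts, hp, dom, FinHeap.single]

/-- Replacing a part of a heap by another one with the same pointers preserves definedness and the
set of pointers. -/
theorem replace {a b x : Heap D} (ha : PCM.defined a) (hb : PCM.defined b) (hd : dom a = dom b)
    (h : PCM.defined (a + x)) : PCM.defined (b + x) ∧ dom (a + x) = dom (b + x) := by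
  change add a x ≠ undef at h
  change add b x ≠ undef ∧ dom (add a x) = dom (add b x)
  cases a with
  | undef => exact absurd rfl ha
  | mk m₁ =>
    cases b with
    | undef => exact absurd rfl hb
    | mk m₂ =>
      cases x with
      | undef => exact absurd rfl h
      | mk m₃ =>
        have hg : ∀ p, m₁.get p = none ↔ m₂.get p = none := by
          intro p
          have := Set.ext_iff.1 hd p
          simp only [dom, Set.mem_ofPred_eq] at this
          tauto
        by_cases h1 : m₁.Disj m₃
        · have h2 : m₂.Disj m₃ := fun p => (h1 p).imp_left (hg p).1
          simp only [add, if_pos h1, if_pos h2]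
          refine ⟨(by intro h; cases h), ?_⟩
          ext p
          simp [dom, FinHeap.union, hg]
        · simp [add, h1] at h

theorem write_inj {p : ℕ} {v w : Val D} {a b : Heap D} (hd : PCM.defined (pts p v + a))
    (h : pts p v + a = pts p w + b) : a = b := by
  by_cases hp : p ≠ 0
  · have hvw : v = w := by
      have hd2 : PCM.defined (pts p w + b) := h ▸ hd
      change add _ _ ≠ undef at hd
      change add _ _ ≠ undef at hd2
      change add _ _ = add _ _ at h
      simp only [pts, dif_pos hp] at hd hd2 h
      cases a with
      | undef => exact absurd rfl hd
      | mk m₁ =>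
        cases b with
        | undef => exact absurd rfl hd2
        | mk m₂ =>
          by_cases h1 : (FinHeap.single p hp v).Disj m₁
          · by_cases h2 : (FinHeap.single p hp w).Disj m₂
            · simp only [add, if_pos h1, if_pos h2] at h
              have hq := congrArg (fun m => FinHeap.get m p) (Heap.mk.inj h)
              simpa [FinHeap.union, FinHeap.single] using hq
            · simp [add, h2] at hd2
          · simp [add, h1] at hd
    subst hvw
    exact cancel hd h
  · exact absurd (by simp only [pts, dif_neg hp]; rfl) hd

end Heap

/-- A state: the thread's own component, the shared component, the component of its environment. -/
@[ext]
structure State (U T : Type) where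
  self : U
  joint : T
  other : U

namespace State

variable {U T U₁ U₂ T₁ T₂ : Type}

def transpose (s : State U T) : State U T := ⟨s.other, s.joint, s.self⟩

/-- Self-framing of `s` with `p`. -/
def sframe [PCM U] (s : State U T) (p : U) : State U T := ⟨s.self + p, s.joint, s.other⟩

/-- Other-framing of `s` with `p`. -/
def oframe [PCM U] (s : State U T) (p : U) : State U T := ⟨s.self, s.joint, p + s.other⟩

def fst (s : State (U₁ × U₂) (T₁ × T₂)) : State U₁ T₁ := ⟨s.self.1, s.joint.1, s.other.1⟩

def snd (s : State (U₁ × U₂) (T₁ × T₂)) : State U₂ T₂ := ⟨s.self.2, s.joint.2, s.other.2⟩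

def pair (s₁ : State U₁ T₁) (s₂ : State U₂ T₂) : State (U₁ × U₂) (T₁ × T₂) :=
  ⟨(s₁.self, s₂.self), (s₁.joint, s₂.joint), (s₁.other, s₂.other)⟩

end State

/-- A predicate that is independent of the framing direction. -/
def Global {U T : Type} [PCM U] (P : State U T → Prop) : Prop :=
  ∀ (s : State U T) p, P (s.sframe p) ↔ P (s.oframe p)

/-- A state space with its flattening to heaps. -/
structure StateSpace (D U T : Type) [PCM U] where
  S : State U T → Prop
  flat : State U T → Heap D
  valid : ∀ s, S s → PCM.defined (s.self + s.other)
  global : Global S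
  flat_valid : ∀ s, S s → PCM.defined (flat s)
  flat_global : ∀ (s : State U T) p, flat (s.sframe p) = flat (s.oframe p)

/-! ## Transitions -/

abbrev Rel (U T : Type) := State U T → State U T → Prop

section Transitions

variable {D U T : Type} [PCM U]

structure IsTransition (C : StateSpace D U T) (t : Rel U T) : Prop where
  functional : ∀ s s₁ s₂, t s s₁ → t s s₂ → s₁ = s₂
  other_fixed : ∀ s s', t s s' → s.other = s'.other
  locality : ∀ (s : State U T) p s', t (s.oframe p) s' →
    ∃ s'', s' = State.oframe s'' p ∧ t (s.sframe p) (s''.sframe p)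
  preserves : ∀ s s', t s s' → C.S s → C.S s'

/-- Internal transitions preserve the pointers of the flattened heap. -/
def IsInternal (C : StateSpace D U T) (t : Rel U T) : Prop :=
  ∀ s s', t s s' → (C.flat s).dom = (C.flat s').dom

/-- The transition over the state space given by the formula `R`: both states are in the state space, and the
other-component does not change. -/
def StateSpace.tr (C : StateSpace D U T) (R : Rel U T) : Rel U T :=
  fun s s' => C.S s ∧ C.S s' ∧ s'.other = s.other ∧ R s s'

/-- The restriction of a transition to the pre-states that satisfy `G`. -/
def guard (G : State U T → Prop) (t : Rel U T) : Rel U T := fun s s' => G s ∧ t s s'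

/-- The idle transition. -/
def StateSpace.skip (C : StateSpace D U T) : Rel U T := fun s s' => C.S s ∧ s' = s

/-- The idle transition, enabled in the states that satisfy `P`. -/
def StateSpace.idTr (C : StateSpace D U T) (P : State U T → Prop) : Rel U T := guard P C.skip

/-- The transitions of `B` and their restrictions by those guards that leave them transitions. -/
def guardClosure (C : StateSpace D U T) (B : Set (Rel U T)) : Set (Rel U T) :=
  {t | IsTransition C t ∧ ∃ t₀ ∈ B, ∃ G, t = guard G t₀}

theorem subset_guardClosure {C : StateSpace D U T} {B : Set (Rel U T)} {t : Rel U T}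
    (h : IsTransition C t) (hB : t ∈ B) : t ∈ guardClosure C B :=
  ⟨h, t, hB, fun _ => True, by funext s s'; simp [guard]⟩

theorem skip_internal (C : StateSpace D U T) : IsInternal C C.skip := by
  rintro s s' ⟨_, rfl⟩
  rfl

theorem idTr_isTransition {C : StateSpace D U T} {P : State U T → Prop}
    (hP : ∀ (s : State U T) p, C.S (s.oframe p) → P (s.oframe p) → P (s.sframe p)) :
    IsTransition C (C.idTr P) where
  functional := by
    rintro s s₁ s₂ ⟨_, _, rfl⟩ ⟨_, _, rfl⟩
    rfl
  other_fixed := by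
    rintro s s' ⟨_, _, rfl⟩
    rfl
  locality := by
    rintro s p s' ⟨hp, hs, rfl⟩
    exact ⟨s, rfl, hP s p hs hp, (C.global s p).2 hs, rfl⟩
  preserves := by
    rintro s s' ⟨_, _, rfl⟩ h
    exact h

theorem skip_eq (C : StateSpace D U T) : C.skip = C.idTr fun _ => True := by
  funext s s'
  simp [StateSpace.idTr, guard]

theorem skip_isTransition (C : StateSpace D U T) : IsTransition C C.skip := by
  rw [skip_eq]
  exact idTr_isTransition fun _ _ _ h => h

theorem tr_isTransition {C : StateSpace D U T} {R : Rel U T}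
    (hf : ∀ s s₁ s₂, C.tr R s s₁ → C.tr R s s₂ → s₁.self = s₂.self ∧ s₁.joint = s₂.joint)
    (hl : ∀ (s : State U T) p s', C.tr R (s.oframe p) s' →
      R (s.sframe p) (State.sframe ⟨s'.self, s'.joint, s.other⟩ p)) :
    IsTransition C (C.tr R) where
  functional s s₁ s₂ h₁ h₂ :=
    State.ext (hf s s₁ s₂ h₁ h₂).1 (hf s s₁ s₂ h₁ h₂).2 (h₁.2.2.1.trans h₂.2.2.1.symm)
  other_fixed s s' h := h.2.2.1.symm
  locality s p s' h := by
    have e : s' = State.oframe ⟨s'.self, s'.joint, s.other⟩ p := State.ext rfl rfl h.2.2.1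
    refine ⟨⟨s'.self, s'.joint, s.other⟩, e, (C.global _ _).2 h.1, (C.global _ _).2 (e ▸ h.2.1),
      rfl, hl s p s' h⟩
  preserves s s' h _ := h.2.1

theorem guard_isTransition {C : StateSpace D U T} {G : State U T → Prop} {t : Rel U T}
    (ht : IsTransition C t) (hS : ∀ s s', t s s' → C.S s)
    (hG : ∀ (s : State U T) p, C.S (s.oframe p) → G (s.oframe p) → G (s.sframe p)) :
    IsTransition C (guard G t) where
  functional s s₁ s₂ a b := ht.functional s s₁ s₂ a.2 b.2
  other_fixed s s' a := ht.other_fixed s s' a.2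
  locality := by
    rintro s p s' ⟨a, b⟩
    obtain ⟨s'', e, h⟩ := ht.locality s p s' b
    exact ⟨s'', e, hG s p (hS _ _ b) a, h⟩
  preserves s s' a := ht.preserves s s' a.2

/-- A union of transitions is a transition if the pre-state determines which of them is taken. -/
theorem exists_isTransition {C : StateSpace D U T} {ι : Type} {t : ι → Rel U T}
    (ht : ∀ i, IsTransition C (t i))
    (hu : ∀ i j s s₁ s₂, t i s s₁ → t j s s₂ → i = j) :
    IsTransition C (fun s s' => ∃ i, t i s s') where
  functional := by
    rintro s s₁ s₂ ⟨i, hi⟩ ⟨j, hj⟩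
    obtain rfl := hu i j s s₁ s₂ hi hj
    exact (ht i).functional s s₁ s₂ hi hj
  other_fixed := by
    rintro s s' ⟨i, hi⟩
    exact (ht i).other_fixed s s' hi
  locality := by
    rintro s p s' ⟨i, hi⟩
    obtain ⟨s'', e, h⟩ := (ht i).locality s p s' hi
    exact ⟨s'', e, i, h⟩
  preserves := by
    rintro s s' ⟨i, hi⟩
    exact (ht i).preserves s s' hi

theorem guard_internal {C : StateSpace D U T} {G : State U T → Prop} {t : Rel U T}
    (h : IsInternal C t) : IsInternal C (guard G t) := fun s s' hs => h s s' hs.2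

theorem transpose_S (C : StateSpace D U T) (s : State U T) : C.S s.transpose ↔ C.S s := by
  have h1 := C.global ⟨0, s.joint, s.other⟩ s.self
  have h2 := C.global ⟨s.other, s.joint, 0⟩ s.self
  have e1 : State.sframe ⟨0, s.joint, s.other⟩ s.self = s := by
    ext <;> simp [State.sframe]
  have e2 : State.oframe ⟨s.other, s.joint, 0⟩ s.self = s.transpose := by
    ext <;> simp [State.oframe, State.transpose]
  have e3 : State.oframe ⟨0, s.joint, s.other⟩ s.self = ⟨0, s.joint, s.self + s.other⟩ := rfl
  have h3 := C.global ⟨0, s.joint, 0⟩ (s.self + s.other)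
  have e4 : State.oframe ⟨0, s.joint, 0⟩ (s.self + s.other) = ⟨0, s.joint, s.self + s.other⟩ := by
    ext <;> simp [State.oframe]
  have e5 : State.sframe ⟨0, s.joint, 0⟩ (s.self + s.other)
      = State.sframe ⟨s.other, s.joint, 0⟩ s.self := by
    ext <;> simp [State.sframe, add_comm]
  rw [e1, e3] at h1
  rw [e2] at h2
  rw [e4, e5] at h3
  rw [h1, ← h3, h2]

end Transitions

/-! ## Products -/

section Products

variable {D U₁ U₂ T₁ T₂ : Type} [PCM U₁] [PCM U₂]

noncomputable def StateSpace.prod (C₁ : StateSpace D U₁ T₁) (C₂ : StateSpace D U₂ T₂) :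
    StateSpace D (U₁ × U₂) (T₁ × T₂) where
  S s := C₁.S s.fst ∧ C₂.S s.snd ∧ PCM.defined (C₁.flat s.fst + C₂.flat s.snd)
  flat s := C₁.flat s.fst + C₂.flat s.snd
  valid s h := ⟨C₁.valid _ h.1, C₂.valid _ h.2.1⟩
  global s p := by
    have h1 := C₁.flat_global s.fst p.1
    have h2 := C₂.flat_global s.snd p.2
    have g1 := C₁.global s.fst p.1
    have g2 := C₂.global s.snd p.2
    change (C₁.S (s.fst.sframe p.1) ∧ C₂.S (s.snd.sframe p.2) ∧
      PCM.defined (C₁.flat (s.fst.sframe p.1) + C₂.flat (s.snd.sframe p.2))) ↔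
      (C₁.S (s.fst.oframe p.1) ∧ C₂.S (s.snd.oframe p.2) ∧
      PCM.defined (C₁.flat (s.fst.oframe p.1) + C₂.flat (s.snd.oframe p.2)))
    rw [h1, h2, g1, g2]
  flat_valid s h := h.2.2
  flat_global s p := by
    change C₁.flat (s.fst.sframe p.1) + C₂.flat (s.snd.sframe p.2)
      = C₁.flat (s.fst.oframe p.1) + C₂.flat (s.snd.oframe p.2)
    rw [C₁.flat_global, C₂.flat_global]

/-- Coupling of transitions: both are taken simultaneously, each on its portion of a state of the
product state space. -/
def couple (C₁ : StateSpace D U₁ T₁) (C₂ : StateSpace D U₂ T₂) (t₁ : Rel U₁ T₁) (t₂ : Rel U₂ T₂) :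
    Rel (U₁ × U₂) (T₁ × T₂) :=
  fun s s' => (C₁.prod C₂).S s ∧ t₁ s.fst s'.fst ∧ t₂ s.snd s'.snd ∧
    PCM.defined ((C₁.prod C₂).flat s')

theorem couple_isTransition {C₁ : StateSpace D U₁ T₁} {C₂ : StateSpace D U₂ T₂} {t₁ : Rel U₁ T₁}
    {t₂ : Rel U₂ T₂} (h₁ : IsTransition C₁ t₁) (h₂ : IsTransition C₂ t₂) :
    IsTransition (C₁.prod C₂) (couple C₁ C₂ t₁ t₂) where
  functional := by
    rintro s s₁ s₂ ⟨_, a1, a2, _⟩ ⟨_, b1, b2, _⟩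
    have e1 := h₁.functional _ _ _ a1 b1
    have e2 := h₂.functional _ _ _ a2 b2
    simp only [State.fst, State.snd, State.mk.injEq] at e1 e2
    exact State.ext (Prod.ext e1.1 e2.1) (Prod.ext e1.2.1 e2.2.1) (Prod.ext e1.2.2 e2.2.2)
  other_fixed := by
    rintro s s' ⟨_, a1, a2, _⟩
    exact Prod.ext (h₁.other_fixed _ _ a1) (h₂.other_fixed _ _ a2)
  locality := by
    rintro s p s' ⟨hs, a1, a2, hd⟩
    obtain ⟨u1, e1, b1⟩ := h₁.locality s.fst p.1 _ a1
    obtain ⟨u2, e2, b2⟩ := h₂.locality s.snd p.2 _ a2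
    have e : s' = (State.pair u1 u2).oframe p := by
      simp only [State.fst, State.snd, State.oframe, State.mk.injEq] at e1 e2
      exact State.ext (Prod.ext e1.1 e2.1) (Prod.ext e1.2.1 e2.2.1) (Prod.ext e1.2.2 e2.2.2)
    refine ⟨State.pair u1 u2, e, ((C₁.prod C₂).global s p).2 hs, b1, b2, ?_⟩
    rw [(C₁.prod C₂).flat_global, ← e]
    exact hd
  preserves := by
    rintro s s' ⟨hs, a1, a2, hd⟩ _
    exact ⟨h₁.preserves _ _ a1 hs.1, h₂.preserves _ _ a2 hs.2.1, hd⟩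

theorem couple_internal {C₁ : StateSpace D U₁ T₁} {C₂ : StateSpace D U₂ T₂} {t₁ : Rel U₁ T₁}
    {t₂ : Rel U₂ T₂} (h₁ : IsTransition C₁ t₁) (h₂ : IsTransition C₂ t₂) (i₁ : IsInternal C₁ t₁)
    (i₂ : IsInternal C₂ t₂) : IsInternal (C₁.prod C₂) (couple C₁ C₂ t₁ t₂) := by
  rintro s s' ⟨hs, a1, a2, hd⟩
  have r1 := Heap.replace (C₁.flat_valid _ hs.1) (C₁.flat_valid _ (h₁.preserves _ _ a1 hs.1))
    (i₁ _ _ a1) hs.2.2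
  have d1 := r1.1
  rw [add_comm] at d1
  have r2 := Heap.replace (C₂.flat_valid _ hs.2.1)
    (C₂.flat_valid _ (h₂.preserves _ _ a2 hs.2.1)) (i₂ _ _ a2) d1
  have r3 := r2.2
  rw [add_comm, add_comm (C₂.flat s'.snd)] at r3
  exact r1.2.trans r3

/-- Internal transitions that are enabled in the components of a state are enabled jointly. -/
theorem couple_enabled {C₁ : StateSpace D U₁ T₁} {C₂ : StateSpace D U₂ T₂} {t₁ : Rel U₁ T₁}
    {t₂ : Rel U₂ T₂} (h₁ : IsTransition C₁ t₁) (h₂ : IsTransition C₂ t₂) (i₁ : IsInternal C₁ t₁)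
    (i₂ : IsInternal C₂ t₂) {s s' : State (U₁ × U₂) (T₁ × T₂)} (hs : (C₁.prod C₂).S s)
    (a1 : t₁ s.fst s'.fst) (a2 : t₂ s.snd s'.snd) : couple C₁ C₂ t₁ t₂ s s' := by
  refine ⟨hs, a1, a2, ?_⟩
  have r1 := Heap.replace (C₁.flat_valid _ hs.1) (C₁.flat_valid _ (h₁.preserves _ _ a1 hs.1))
    (i₁ _ _ a1) hs.2.2
  have d1 := r1.1
  rw [add_comm] at d1
  have r2 := (Heap.replace (C₂.flat_valid _ hs.2.1)
    (C₂.flat_valid _ (h₂.preserves _ _ a2 hs.2.1)) (i₂ _ _ a2) d1).1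
  rw [add_comm] at r2
  exact r2

end Products

/-! ## Resources -/

structure Resource (D : Type) where
  U : Type
  T : Type
  [pcm : PCM U]
  space : StateSpace D U T
  int : Set (Rel U T)
  ext : Set (Rel U T)
  int_trans : ∀ t ∈ int, IsTransition space t ∧ IsInternal space t
  ext_trans : ∀ t ∈ ext, IsTransition space t

namespace Resource

variable {D : Type}

instance (V : Resource D) : PCM V.U := V.pcm

abbrev St (V : Resource D) : Type := State V.U V.T

def S (V : Resource D) : V.St → Prop := V.space.S

/-- The internal transitions of `V`, as a type. -/
def Int (V : Resource D) : Type := {t : Rel V.U V.T // t ∈ V.int}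

def ostep (V : Resource D) (s s' : V.St) : Prop :=
  ∃ t ∈ V.int ∪ V.ext, t s.transpose s'.transpose

/-- Interference of the environment: any number of other-steps. -/
def osteps (V : Resource D) : V.St → V.St → Prop := Relation.ReflTransGen V.ostep

def Inductive (V : Resource D) (I : V.St → Prop) : Prop :=
  ∀ t ∈ V.int, ∀ s s', t s s' → I s → I s'

/-- The restriction `V / I`. -/
def restrict (V : Resource D) (I : V.St → Prop) (hg : Global I) (hi : V.Inductive I) :
    Resource D where
  U := V.U
  T := V.T
  space :=
    { S := fun s => V.space.S s ∧ I s
      flat := V.space.flat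
      valid := fun s h => V.space.valid s h.1
      global := fun s p => and_congr (V.space.global s p) (hg s p)
      flat_valid := fun s h => V.space.flat_valid s h.1
      flat_global := V.space.flat_global }
  int := V.int
  ext := {t | ∃ t' ∈ V.ext, ∀ s s', t s s' ↔ t' s s' ∧ I s'}
  int_trans := by
    intro t ht
    obtain ⟨h, h'⟩ := V.int_trans t ht
    exact ⟨⟨h.functional, h.other_fixed, h.locality,
      fun s s' hs hS => ⟨h.preserves s s' hs hS.1, hi t ht s s' hs hS.2⟩⟩, h'⟩
  ext_trans := by
    rintro t ⟨t', ht', he⟩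
    have h := V.ext_trans t' ht'
    refine ⟨fun s s₁ s₂ a b => h.functional s s₁ s₂ ((he _ _).1 a).1 ((he _ _).1 b).1,
      fun s s' a => h.other_fixed s s' ((he _ _).1 a).1, ?_,
      fun s s' a hS => ⟨h.preserves s s' ((he _ _).1 a).1 hS.1, ((he _ _).1 a).2⟩⟩
    intro s p s' a
    obtain ⟨a1, a2⟩ := (he _ _).1 a
    obtain ⟨s'', e, b⟩ := h.locality s p s' a1
    exact ⟨s'', e, (he _ _).2 ⟨b, (hg s'' p).2 (e ▸ a2)⟩⟩

theorem ostep_S {V : Resource D} {s s' : V.St} (h : V.ostep s s') (hs : V.S s) : V.S s' := by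
  obtain ⟨t, ht, h⟩ := h
  have htr : IsTransition V.space t := ht.elim (fun a => (V.int_trans t a).1) (V.ext_trans t)
  exact (transpose_S V.space s').1 (htr.preserves _ _ h ((transpose_S V.space s).2 hs))

theorem osteps_S {V : Resource D} {s s' : V.St} (h : V.osteps s s') (hs : V.S s) : V.S s' := by
  induction h with
  | refl => exact hs
  | tail _ h ih => exact ostep_S h ih

end Resource

/-! ## Actions and morphisms -/

section Morphisms

variable {D : Type}

/-- Atomic actions over `V` with return values in `A`. -/
structure Action (V : Resource D) (A : Type) where
  rel : A → V.St → V.St → Prop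
  internal : ∀ v, rel v ∈ V.int
  functional : ∀ v₁ v₂ s s₁ s₂, rel v₁ s s₁ → rel v₂ s s₂ → v₁ = v₂

/-- Families of morphisms from `V` to `W` indexed by `X`. -/
structure Family (X : Type) (V W : Resource D) where
  rel : X → V.St → W.St → Prop
  tr : X → V.Int → W.Int
  rel_valid : ∀ x sv sw, rel x sv sw → V.S sv ∧ W.S sw
  sim_int : ∀ x (t : V.Int) sv sv' sw, t.1 sv sv' → rel x sv sw →
    ∃ x' sw', (tr x t).1 sw sw' ∧ rel x' sv' sw'
  sim_other : ∀ x sv sw sw', W.osteps sw sw' → rel x sv sw →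
    ∃ sv', V.osteps sv sv' ∧ rel x sv' sw'
  functional : ∀ x sv₁ sv₂ sw, rel x sv₁ sw → rel x sv₂ sw → sv₁ = sv₂
  frame : ∃ φ : W.U → V.U, ∀ x sv (sw : W.St) p, rel x sv (sw.oframe p) →
    ∃ sv' : V.St, sv = sv'.oframe (φ p) ∧ rel x (sv'.sframe (φ p)) (sw.sframe p)
  other_fixed : ∀ x x' sv sv' sw sw', rel x sv sw → rel x' sv' sw' →
    sw.other = sw'.other → sv.other = sv'.other
  index_inj : ∀ x₁ x₂ sv sw₁ sw₂, rel x₁ sv sw₁ → rel x₂ sv sw₂ → x₁ = x₂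

/-- Morphisms are the families over the one-point index type. -/
abbrev Morphism (V W : Resource D) := Family Unit V W

/-- The generic morphism from `V` to `V / I`: the identity on states and on transitions. -/
def restrictMorphism (V : Resource D) (I : V.St → Prop) (hg : Global I) (hi : V.Inductive I) :
    Morphism V (V.restrict I hg hi) where
  rel _ sv sw := sv = sw ∧ (V.restrict I hg hi).S sw
  tr _ t := t
  rel_valid := by
    rintro _ sv sw ⟨rfl, h⟩
    exact ⟨h.1, h⟩
  sim_int := by
    rintro _ t sv sv' sw ht ⟨rfl, h⟩
    exact ⟨(), sv', ht, rfl, (V.int_trans t.1 t.2).1.preserves _ _ ht h.1, hi t.1 t.2 _ _ ht h.2⟩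
  sim_other := by
    rintro _ sv sw sw' h ⟨rfl, hs⟩
    refine ⟨sw', ?_, rfl, Resource.osteps_S h hs⟩
    clear hs
    induction h with
    | refl => exact Relation.ReflTransGen.refl
    | tail _ h ih =>
      refine ih.tail ?_
      obtain ⟨t, ht | ⟨t', ht', he⟩, h⟩ := h
      · exact ⟨t, Or.inl ht, h⟩
      · exact ⟨t', Or.inr ht', ((he _ _).1 h).1⟩
  functional := by
    rintro _ sv₁ sv₂ sw ⟨rfl, _⟩ ⟨rfl, _⟩
    rfl
  frame := by
    refine ⟨id, ?_⟩
    rintro _ sv sw p ⟨rfl, h⟩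
    exact ⟨sw, rfl, rfl, ((V.restrict I hg hi).space.global sw p).2 h⟩
  other_fixed := by
    rintro _ _ sv sv' sw sw' ⟨rfl, _⟩ ⟨rfl, _⟩ h
    exact h
  index_inj := fun _ _ _ _ _ _ _ => rfl

end Morphisms

/-! ## Action trees, programs, Hoare types -/

section Programs

variable {D : Type}

inductive ActTree : Resource D → Type → Type 1 where
  | unfinished {V : Resource D} {A : Type} : ActTree V A
  | ret {V : Resource D} {A : Type} (v : A) : ActTree V A
  | act {V : Resource D} {A : Type} (a : Action V A) : ActTree V A
  | seq {V : Resource D} {A B : Type} (T : ActTree V B) (K : B → ActTree V A) : ActTree V A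
  | par {V : Resource D} {A B₁ B₂ : Type} (T₁ : ActTree V B₁) (T₂ : ActTree V B₂)
      (K : B₁ × B₂ → ActTree V A) : ActTree V A
  | morph {V W : Resource D} {A X : Type} (f : Family X W V) (x : X) (T : ActTree W A) : ActTree V A

/-- Positions in trees. -/
inductive Path where
  | choiceAct
  | seqRet
  | seqStep (π : Path)
  | parRet
  | parL (π : Path)
  | parR (π : Path)
  | morphRet
  | morphStep (π : Path)

/-- `Admin T π T'`: the redex of `T` at `π` is not an action, and reducing it, which does not change the state,
gives `T'`. -/
inductive Admin : {V : Resource D} → {A : Type} → ActTree V A → Path → ActTree V A → Prop where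
  | seqRet {V : Resource D} {A B : Type} (v : B) (K : B → ActTree V A) :
      Admin (.seq (.ret v) K) .seqRet (K v)
  | seqStep {V : Resource D} {A B : Type} {T T' : ActTree V B} {π : Path} (K : B → ActTree V A) :
      Admin T π T' → Admin (.seq T K) (.seqStep π) (.seq T' K)
  | parRet {V : Resource D} {A B₁ B₂ : Type} (v₁ : B₁) (v₂ : B₂) (K : B₁ × B₂ → ActTree V A) :
      Admin (.par (.ret v₁) (.ret v₂) K) .parRet (K (v₁, v₂))
  | parL {V : Resource D} {A B₁ B₂ : Type} {T₁ T₁' : ActTree V B₁} {π : Path} (T₂ : ActTree V B₂)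
      (K : B₁ × B₂ → ActTree V A) :
      Admin T₁ π T₁' → Admin (.par T₁ T₂ K) (.parL π) (.par T₁' T₂ K)
  | parR {V : Resource D} {A B₁ B₂ : Type} (T₁ : ActTree V B₁) {T₂ T₂' : ActTree V B₂} {π : Path}
      (K : B₁ × B₂ → ActTree V A) :
      Admin T₂ π T₂' → Admin (.par T₁ T₂ K) (.parR π) (.par T₁ T₂' K)
  | morphRet {V W : Resource D} {A X : Type} (f : Family X W V) (y : X) (v : A) :
      Admin (.morph f y (.ret v)) .morphRet (.ret v)
  | morphStep {V W : Resource D} {A X : Type} (f : Family X W V) (y : X) {T T' : ActTree W A}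
      {π : Path} :
      Admin T π T' → Admin (.morph f y T) (.morphStep π) (.morph f y T')

/-- `Fire T π t s s' T'`: in the state `s` the tree `T` executes the action at `π` by the internal transition `t`,
ending in the state `s'` with the tree `T'` left to execute. Under a morphism `f` at index `y` the transition
taken is the image under `f y` of the one that the inner tree takes on the related states. -/
inductive Fire : {V : Resource D} → {A : Type} →
    ActTree V A → Path → V.Int → V.St → V.St → ActTree V A → Prop where
  | act {V : Resource D} {A : Type} (a : Action V A) (v : A) {s s' : V.St} :
      a.rel v s s' → Fire (.act a) .choiceAct ⟨a.rel v, a.internal v⟩ s s' (.ret v)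
  | seqStep {V : Resource D} {A B : Type} {T T' : ActTree V B} {π : Path} {t : V.Int} {s s' : V.St}
      (K : B → ActTree V A) :
      Fire T π t s s' T' → Fire (.seq T K) (.seqStep π) t s s' (.seq T' K)
  | parL {V : Resource D} {A B₁ B₂ : Type} {T₁ T₁' : ActTree V B₁} {π : Path} {t : V.Int}
      {s s' : V.St} (T₂ : ActTree V B₂) (K : B₁ × B₂ → ActTree V A) :
      Fire T₁ π t s s' T₁' → Fire (.par T₁ T₂ K) (.parL π) t s s' (.par T₁' T₂ K)
  | parR {V : Resource D} {A B₁ B₂ : Type} (T₁ : ActTree V B₁) {T₂ T₂' : ActTree V B₂} {π : Path}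
      {t : V.Int} {s s' : V.St} (K : B₁ × B₂ → ActTree V A) :
      Fire T₂ π t s s' T₂' → Fire (.par T₁ T₂ K) (.parR π) t s s' (.par T₁ T₂' K)
  | morphStep {V W : Resource D} {A X : Type} (f : Family X W V) (y y' : X) {T T' : ActTree W A}
      {π : Path} {t : W.Int} {r r' : W.St} {s s' : V.St} :
      f.rel y r s → Fire T π t r r' T' → f.rel y' r' s' → (f.tr y t).1 s s' →
      Fire (.morph f y T) (.morphStep π) (f.tr y t) s s' (.morph f y' T')

/-- One step of the operational semantics: `s, T` reduces along the path `π` to `s', T'`. -/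
def Step {V : Resource D} {A : Type} (s : V.St) (T : ActTree V A) (π : Path) (s' : V.St)
    (T' : ActTree V A) : Prop :=
  (Admin T π T' ∧ s' = s) ∨ ∃ t, Fire T π t s s' T'

/-- The path determines an action or a redex in the tree. -/
inductive Good : {V : Resource D} → {A : Type} → ActTree V A → Path → Prop where
  | act {V : Resource D} {A : Type} (a : Action V A) : Good (.act a) .choiceAct
  | seqRet {V : Resource D} {A B : Type} (v : B) (K : B → ActTree V A) :
      Good (.seq (.ret v) K) .seqRet
  | seqStep {V : Resource D} {A B : Type} {T : ActTree V B} {π : Path} (K : B → ActTree V A) :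
      Good T π → Good (.seq T K) (.seqStep π)
  | parRet {V : Resource D} {A B₁ B₂ : Type} (v₁ : B₁) (v₂ : B₂) (K : B₁ × B₂ → ActTree V A) :
      Good (.par (.ret v₁) (.ret v₂) K) .parRet
  | parL {V : Resource D} {A B₁ B₂ : Type} {T₁ : ActTree V B₁} {π : Path} (T₂ : ActTree V B₂)
      (K : B₁ × B₂ → ActTree V A) : Good T₁ π → Good (.par T₁ T₂ K) (.parL π)
  | parR {V : Resource D} {A B₁ B₂ : Type} (T₁ : ActTree V B₁) {T₂ : ActTree V B₂} {π : Path}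
      (K : B₁ × B₂ → ActTree V A) : Good T₂ π → Good (.par T₁ T₂ K) (.parR π)
  | morphRet {V W : Resource D} {A X : Type} (f : Family X W V) (y : X) (v : A) :
      Good (.morph f y (.ret v)) .morphRet
  | morphStep {V W : Resource D} {A X : Type} (f : Family X W V) (y : X) {T : ActTree W A}
      {π : Path} : Good T π → Good (.morph f y T) (.morphStep π)

variable {V : Resource D} {A B : Type}

def Safe (T : ActTree V A) (π : Path) (s : V.St) : Prop := Good T π → ∃ s' T', Step s T π s' T'

def alwaysAlong (X : V.St → ActTree V A → Prop) : List Path → ActTree V A → V.St → Prop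
  | [], T, s => ∀ s₂, V.osteps s s₂ → X s₂ T
  | π :: ζ, T, s => ∀ s₂, V.osteps s s₂ → Safe T π s₂ ∧ X s₂ T ∧
      ∀ s₃ T', Step s₂ T π s₃ T' → alwaysAlong X ζ T' s₃

def always (T : ActTree V A) (X : V.St → ActTree V A → Prop) (s : V.St) : Prop :=
  ∀ ζ, alwaysAlong X ζ T s

def after (T : ActTree V A) (Q : A → V.St → Prop) : V.St → Prop :=
  always T fun s' T' => ∀ v, T' = .ret v → Q v s'

variable (V A) in
/-- Programs: sets of finite approximations, always including the trivial one. -/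
def ST : Type 1 := {e : Set (ActTree V A) // ActTree.unfinished ∈ e}

def vrf (e : ST V A) (Q : A → V.St → Prop) (s : V.St) : Prop := V.S s ∧ ∀ T ∈ e.1, after T Q s

/-- The Hoare type `[Γ]. {P} A {Q} @ V`. -/
def HoareType {Γ : Type} (V : Resource D) (P : Γ → V.St → Prop) (Q : Γ → A → V.St → Prop) :
    Set (ST V A) :=
  {e | ∀ g s, V.S s → P g s → vrf e (Q g) s}

namespace ST

def ret (v : A) : ST V A := ⟨{.unfinished, .ret v}, Or.inl rfl⟩

def bind (e₁ : ST V B) (e₂ : B → ST V A) : ST V A :=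
  ⟨{.unfinished} ∪ {T | ∃ T₁ K, T = .seq T₁ K ∧ T₁ ∈ e₁.1 ∧ ∀ x, K x ∈ (e₂ x).1}, Or.inl rfl⟩

def atomic (a : Action V A) : ST V A := ⟨{.unfinished, .act a}, Or.inl rfl⟩

def morph {W : Resource D} {X : Type} (f : Family X W V) (x : X) (e : ST W A) : ST V A :=
  ⟨{.unfinished} ∪ {T | ∃ T₁ ∈ e.1, T = .morph f x T₁}, Or.inl rfl⟩

/-- The least fixed point of a monotone map on programs, as the intersection of all pre-fixed points. -/
def fix (F : ST V A → ST V A) : ST V A :=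
  ⟨{T | ∀ e : ST V A, (F e).1 ⊆ e.1 → T ∈ e.1}, fun e _ => e.2⟩

end ST

end Programs

/-! ## The resource for spin locks -/

/-- Ownership of a lock: `own`, its absence `free` (the unit), and the undefined `own + own`. -/
inductive Own where
  | own
  | free
  | undef

namespace Own

def add : Own → Own → Own
  | free, x => x
  | x, free => x
  | _, _ => undef

instance : Add Own := ⟨add⟩

instance : Zero Own := ⟨free⟩

instance : PCM Own where
  add_assoc a b c := by cases a <;> cases b <;> cases c <;> rfl
  add_comm a b := by cases a <;> cases b <;> rfl
  zero_add a := by cases a <;> rfl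
  add_zero a := by cases a <;> rfl
  nsmul := nsmulRec
  defined x := x ≠ undef
  defined_zero := by intro h; cases h
  defined_left a b h := by
    rintro rfl
    cases b <;> exact h rfl

theorem add_eq_free {a b : Own} : a + b = free ↔ a = free ∧ b = free := by
  cases a <;> cases b <;> simp [HAdd.hAdd, Add.add, add]

theorem own_add_defined {a : Own} : PCM.defined (own + a) ↔ a = free := by
  cases a <;> simp [HAdd.hAdd, Add.add, add, PCM.defined]

theorem free_add (a : Own) : free + a = a := zero_add a

theorem add_free (a : Own) : a + free = a := add_zero a

end Own

/-- `lam`: the lock is taken. `pi`: the lock may be released. -/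
@[ext]
structure SpinJoint where
  lam : Bool
  pi : Bool

section Spin

variable {D : Type}

/-- State space of the spin lock at the pointer `r`. -/
def spinSpace (D : Type) (r : ℕ) : StateSpace D Own SpinJoint where
  S s := PCM.defined (s.self + s.other) ∧ r ≠ 0 ∧
    (s.joint.lam = false → s.self + s.other = Own.free ∧ s.joint.pi = true)
  flat s := Heap.pts r (.bool s.joint.lam)
  valid s h := h.1
  global s p := by simp only [State.sframe, State.oframe, add_assoc]
  flat_valid s h := Heap.pts_defined h.2.1 _
  flat_global s p := rfl

def spinLockTr (D : Type) (r : ℕ) (x : Own) : Rel Own SpinJoint :=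
  (spinSpace D r).tr fun s s' =>
    s.joint.lam = false ∧ s'.joint.lam = true ∧ s'.self = x ∧ s'.joint.pi = true

def spinUnlockTr (D : Type) (r : ℕ) (x : Own) : Rel Own SpinJoint :=
  (spinSpace D r).tr fun s s' =>
    s.joint.lam = true ∧ s.self = x ∧ s.other = .free ∧ s.joint.pi = true ∧ s'.joint.lam = false

def spinSetTr (D : Type) (r : ℕ) (x : Own) (b : Bool) : Rel Own SpinJoint :=
  (spinSpace D r).tr fun s s' =>
    s.joint.lam = true ∧ s.self = x ∧ s.other = .free ∧
    s'.joint.lam = true ∧ s'.self = x ∧ s'.joint.pi = b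

theorem spinLock_isTransition (r : ℕ) (x : Own) :
    IsTransition (spinSpace D r) (spinLockTr D r x) := by
  refine tr_isTransition ?_ ?_
  · rintro s s₁ s₂ ⟨_, _, _, _, a1, a2, a3⟩ ⟨_, _, _, _, b1, b2, b3⟩
    exact ⟨a2.trans b2.symm, SpinJoint.ext (a1.trans b1.symm) (a3.trans b3.symm)⟩
  · rintro s p s' ⟨h1, _, _, a0, a1, a2, a3⟩
    have h := (Own.add_eq_free.1 (h1.2.2 a0).1).2
    have hp : p = 0 := (Own.add_eq_free.1 h).1
    subst hp
    exact ⟨a0, a1, (add_zero _).trans a2, a3⟩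

theorem spinUnlock_isTransition (r : ℕ) (x : Own) :
    IsTransition (spinSpace D r) (spinUnlockTr D r x) := by
  refine tr_isTransition ?_ ?_
  · rintro s s₁ s₂ ⟨_, h1, _, _, _, _, _, a⟩ ⟨_, h2, _, _, _, _, _, b⟩
    have e1 := h1.2.2 a
    have e2 := h2.2.2 b
    exact ⟨(Own.add_eq_free.1 e1.1).1.trans (Own.add_eq_free.1 e2.1).1.symm,
      SpinJoint.ext (a.trans b.symm) (e1.2.trans e2.2.symm)⟩
  · rintro s p s' ⟨_, _, _, a0, a1, a2, a3, a4⟩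
    have h := Own.add_eq_free.1 a2
    have hp : p = 0 := h.1
    subst hp
    exact ⟨a0, (add_zero _).trans a1, h.2, a3, a4⟩

theorem spinSet_isTransition (r : ℕ) (x : Own) (b : Bool) :
    IsTransition (spinSpace D r) (spinSetTr D r x b) := by
  refine tr_isTransition ?_ ?_
  · rintro s s₁ s₂ ⟨_, _, _, _, _, _, a1, a2, a3⟩ ⟨_, _, _, _, _, _, b1, b2, b3⟩
    exact ⟨a2.trans b2.symm, SpinJoint.ext (a1.trans b1.symm) (a3.trans b3.symm)⟩
  · rintro s p s' ⟨_, _, _, a0, a1, a2, a3, a4, a5⟩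
    have h := Own.add_eq_free.1 a2
    have hp : p = 0 := h.1
    subst hp
    exact ⟨a0, (add_zero _).trans a1, h.2, a3, (add_zero _).trans a4, a5⟩

theorem spin_internal (r : ℕ) (R : Rel Own SpinJoint) :
    IsInternal (spinSpace D r) ((spinSpace D r).tr R) := by
  rintro s s' ⟨h, h', _⟩
  change Heap.dom (Heap.pts r _) = Heap.dom (Heap.pts r _)
  rw [Heap.dom_pts h.2.1, Heap.dom_pts h.2.1]

/-- The basic internal transitions of the spin lock: exclusive locking and unlocking, and idling. -/
def spinBase (D : Type) (r : ℕ) : Set (Rel Own SpinJoint) :=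
  {spinLockTr D r .own, spinUnlockTr D r .own, (spinSpace D r).skip}

/-- The spin lock with an exclusive and a non-exclusive mode of ownership. -/
def spinRes (D : Type) (r : ℕ) : Resource D where
  U := Own
  T := SpinJoint
  space := spinSpace D r
  int := guardClosure (spinSpace D r) (spinBase D r)
  ext := {t | t = spinLockTr D r .free ∨ t = spinUnlockTr D r .free ∨
    ∃ b, t = spinSetTr D r .own b ∨ t = spinSetTr D r .free b}
  int_trans := by
    rintro t ⟨h, t₀, ht, G, rfl⟩
    refine ⟨h, guard_internal ?_⟩
    rcases ht with rfl | rfl | rfl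
    · exact spin_internal r _
    · exact spin_internal r _
    · exact skip_internal _
  ext_trans := by
    rintro t (rfl | rfl | ⟨b, rfl | rfl⟩)
    · exact spinLock_isTransition r _
    · exact spinUnlock_isTransition r _
    · exact spinSet_isTransition r _ _
    · exact spinSet_isTransition r _ _

/-- One attempt to take the lock, returning whether it was successful; it fails only if the lock is taken. -/
def trylockAct (D : Type) (r : ℕ) : Action (spinRes D r) Bool where
  rel b := if b then spinLockTr D r .own else (spinSpace D r).idTr fun s => s.joint.lam = true
  internal b := by
    cases b
    · exact ⟨idTr_isTransition fun s p _ h => h, _, Or.inr (Or.inr rfl), _, rfl⟩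
    · exact subset_guardClosure (spinLock_isTransition r _) (Or.inl rfl)
  functional := by
    intro v₁ v₂ s s₁ s₂ h₁ h₂
    cases v₁ <;> cases v₂ <;> first | rfl | skip
    · exact absurd (h₁.1.symm.trans h₂.2.2.2.1) (by decide)
    · exact absurd (h₂.1.symm.trans h₁.2.2.2.1) (by decide)

/-- The locking loop. -/
def lock (D : Type) (r : ℕ) : ST (spinRes D r) Unit :=
  ST.fix fun loop => (ST.atomic (trylockAct D r)).bind fun b => if b then ST.ret () else loop

end Spin

/-! ## Shared heaps, private heaps, counting -/

/-- The shared heap, and whether it is present. -/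
@[ext]
structure SharJoint (D : Type) where
  heap : Heap D
  nu : Bool

section Components

variable {D : Type}

/-- Shared heap with the invariant `I`. -/
noncomputable def sharSpace (I : Heap D → Prop) : StateSpace D Unit (SharJoint D) where
  S s := PCM.defined s.joint.heap ∧ if s.joint.nu then I s.joint.heap else s.joint.heap = 0
  flat s := s.joint.heap
  valid _ _ := trivial
  global _ _ := Iff.rfl
  flat_valid _ h := h.1
  flat_global _ _ := rfl

def sharTakeTr (I : Heap D → Prop) (h : Heap D) : Rel Unit (SharJoint D) :=
  (sharSpace I).tr fun s s' =>
    I h ∧ s.joint.nu = false ∧ s'.joint.heap = h ∧ s'.joint.nu = true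

def sharGiveTr (I : Heap D → Prop) (h : Heap D) : Rel Unit (SharJoint D) :=
  (sharSpace I).tr fun s s' =>
    h = s.joint.heap ∧ s.joint.nu = true ∧ s'.joint.heap = 0 ∧ s'.joint.nu = false

/-- Private heaps. -/
noncomputable def privSpace (D : Type) : StateSpace D (Heap D) Unit where
  S s := PCM.defined (s.self + s.other)
  flat s := s.self + s.other
  valid s h := h
  global s p := by simp only [State.sframe, State.oframe, add_assoc]
  flat_valid s h := h
  flat_global s p := by simp only [State.sframe, State.oframe, add_assoc]

def privTakeTr (h : Heap D) : Rel (Heap D) Unit :=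
  (privSpace D).tr fun s s' => s'.self = h + s.self

def privGiveTr (h : Heap D) : Rel (Heap D) Unit :=
  (privSpace D).tr fun s s' => s.self = h + s'.self

/-- Mutation of the private pointer `p` to the value `v`. -/
def privWriteTr (p : ℕ) (v : Val D) : Rel (Heap D) Unit :=
  (privSpace D).tr fun s s' => ∃ w h, s.self = Heap.pts p w + h ∧ s'.self = Heap.pts p v + h

/-- Registration count, kept in the pointer `ct`; the joint component is the boolean `ι`. -/
def countSpace (D : Type) (ct : ℕ) : StateSpace D ℕ Bool where
  S s := ct ≠ 0 ∧ (s.self + s.other > 0 → s.joint = true)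
  flat s := Heap.pts ct (.nat (s.self + s.other))
  valid s _ := trivial
  global s p := by simp only [State.sframe, State.oframe, add_assoc]
  flat_valid s h := Heap.pts_defined h.1 _
  flat_global s p := by simp only [State.sframe, State.oframe, add_assoc]

def countIncrTr (D : Type) (ct : ℕ) : Rel ℕ Bool :=
  (countSpace D ct).tr fun s s' => s.joint = true ∧ s'.self = s.self + 1

def countDecrTr (D : Type) (ct : ℕ) : Rel ℕ Bool :=
  (countSpace D ct).tr fun s s' => s'.self + 1 = s.self ∧ s'.joint = true

def countSetTr (D : Type) (ct : ℕ) (b : Bool) : Rel ℕ Bool :=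
  (countSpace D ct).tr fun s s' => s.self + s.other = 0 ∧ s'.self + s'.other = 0 ∧ s'.joint = b

theorem sharTake_isTransition (I : Heap D → Prop) (h : Heap D) :
    IsTransition (sharSpace I) (sharTakeTr I h) := by
  refine tr_isTransition ?_ ?_
  · rintro s s₁ s₂ ⟨_, _, _, _, _, a1, a2⟩ ⟨_, _, _, _, _, b1, b2⟩
    exact ⟨rfl, SharJoint.ext (a1.trans b1.symm) (a2.trans b2.symm)⟩
  · rintro s p s' ⟨_, _, _, h⟩
    exact h

theorem sharGive_isTransition (I : Heap D → Prop) (h : Heap D) :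
    IsTransition (sharSpace I) (sharGiveTr I h) := by
  refine tr_isTransition ?_ ?_
  · rintro s s₁ s₂ ⟨_, _, _, _, _, a1, a2⟩ ⟨_, _, _, _, _, b1, b2⟩
    exact ⟨rfl, SharJoint.ext (a1.trans b1.symm) (a2.trans b2.symm)⟩
  · rintro s p s' ⟨_, _, _, h⟩
    exact h

theorem privTake_isTransition (h : Heap D) : IsTransition (privSpace D) (privTakeTr h) := by
  refine tr_isTransition ?_ ?_
  · rintro s s₁ s₂ ⟨_, _, _, a⟩ ⟨_, _, _, b⟩
    exact ⟨a.trans b.symm, rfl⟩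
  · rintro s p s' ⟨_, _, _, a⟩
    simp only [State.sframe, State.oframe] at a ⊢
    rw [a, add_assoc]

theorem privGive_isTransition (h : Heap D) : IsTransition (privSpace D) (privGiveTr h) := by
  refine tr_isTransition ?_ ?_
  · rintro s s₁ s₂ ⟨h0, _, _, a⟩ ⟨_, _, _, b⟩
    have hd := PCM.defined_left _ _ ((privSpace D).valid _ h0)
    exact ⟨Heap.cancel (a ▸ hd) (a.symm.trans b), rfl⟩
  · rintro s p s' ⟨_, _, _, a⟩
    simp only [State.sframe, State.oframe] at a ⊢
    rw [a, add_assoc]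

theorem privWrite_isTransition (p : ℕ) (v : Val D) :
    IsTransition (privSpace D) (privWriteTr p v) := by
  refine tr_isTransition ?_ ?_
  · rintro s s₁ s₂ ⟨h0, _, _, w, h, a, a'⟩ ⟨_, _, _, w2, h2, b, b'⟩
    have hd := PCM.defined_left _ _ ((privSpace D).valid _ h0)
    have e := Heap.write_inj (a ▸ hd) (a.symm.trans b)
    exact ⟨by rw [a', b', e], rfl⟩
  · rintro s q s' ⟨_, _, _, w, h, a, a'⟩
    refine ⟨w, h + q, ?_, ?_⟩
    · simp only [State.sframe, State.oframe] at a ⊢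
      rw [a, add_assoc]
    · simp only [State.sframe] at a' ⊢
      rw [a', add_assoc]

theorem privWrite_internal (p : ℕ) (v : Val D) : IsInternal (privSpace D) (privWriteTr p v) := by
  rintro s s' ⟨h, h', e, w, k, a, b⟩
  have hp : p ≠ 0 := by
    rintro rfl
    have hd := PCM.defined_left _ _ ((privSpace D).valid _ h)
    rw [a] at hd
    exact absurd rfl hd
  change Heap.dom (s.self + s.other) = Heap.dom (s'.self + s'.other)
  have hd := (privSpace D).valid _ h
  rw [a, add_assoc] at hd
  rw [e, a, b, add_assoc, add_assoc]
  exact (Heap.replace (Heap.pts_defined hp w) (Heap.pts_defined hp v)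
    (by rw [Heap.dom_pts hp, Heap.dom_pts hp]) hd).2

theorem countIncr_isTransition (ct : ℕ) : IsTransition (countSpace D ct) (countIncrTr D ct) := by
  refine tr_isTransition ?_ ?_
  · rintro s s₁ s₂ ⟨_, h1, _, _, a⟩ ⟨_, h2, _, _, b⟩
    exact ⟨a.trans b.symm, (h1.2 (by omega)).trans (h2.2 (by omega)).symm⟩
  · rintro s p s' ⟨_, _, _, a, b⟩
    refine ⟨a, ?_⟩
    simp only [State.sframe, State.oframe] at b ⊢
    omega

theorem countDecr_isTransition (ct : ℕ) : IsTransition (countSpace D ct) (countDecrTr D ct) := by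
  refine tr_isTransition ?_ ?_
  · rintro s s₁ s₂ ⟨_, _, _, a, a'⟩ ⟨_, _, _, b, b'⟩
    exact ⟨by omega, a'.trans b'.symm⟩
  · rintro s p s' ⟨_, _, _, a, b⟩
    refine ⟨?_, b⟩
    simp only [State.sframe, State.oframe] at a ⊢
    omega

theorem countSet_isTransition (ct : ℕ) (b : Bool) :
    IsTransition (countSpace D ct) (countSetTr D ct b) := by
  refine tr_isTransition ?_ ?_
  · rintro s s₁ s₂ ⟨_, _, _, _, a, a'⟩ ⟨_, _, _, _, b, b'⟩
    exact ⟨by omega, a'.trans b'.symm⟩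
  · rintro s p s' ⟨_, _, e, a, b, c⟩
    simp only [State.sframe, State.oframe] at a e ⊢
    exact ⟨by omega, by omega, c⟩

theorem count_internal (ct : ℕ) (R : Rel ℕ Bool) :
    IsInternal (countSpace D ct) ((countSpace D ct).tr R) := by
  rintro s s' ⟨h, h', _⟩
  change Heap.dom (Heap.pts ct _) = Heap.dom (Heap.pts ct _)
  rw [Heap.dom_pts h.1, Heap.dom_pts h.1]

end Components

/-! ## The readers/writers lock -/

/-- The locks of the writers and of the readers, the counter, and the invariant of the protected heap. -/
structure RWParams (D : Type) where
  wr : ℕ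
  rd : ℕ
  ct : ℕ
  I : Heap D → Prop

abbrev RWState (D : Type) :=
  State (((Own × Unit) × Heap D) × ((Own × ℕ) × Unit))
    (((SpinJoint × SharJoint D) × Unit) × ((SpinJoint × Bool) × SharJoint D))

namespace RWState

variable {D : Type}

def wrPart (s : RWState D) : State Own SpinJoint := s.fst.fst.fst

def sharPart (s : RWState D) : State Unit (SharJoint D) := s.fst.fst.snd

def privPart (s : RWState D) : State (Heap D) Unit := s.fst.snd

def rdPart (s : RWState D) : State Own SpinJoint := s.snd.fst.fst

def countPart (s : RWState D) : State ℕ Bool := s.snd.fst.snd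

def sharPart₂ (s : RWState D) : State Unit (SharJoint D) := s.snd.snd

def lam (s : RWState D) : Bool := s.wrPart.joint.lam

def pi (s : RWState D) : Bool := s.wrPart.joint.pi

def mu (s : RWState D) : Own := s.wrPart.self + s.wrPart.other

def nu (s : RWState D) : Bool := s.sharPart.joint.nu

/-- The private heap of the thread. -/
def sigmaS (s : RWState D) : Heap D := s.privPart.self

def lam₂ (s : RWState D) : Bool := s.rdPart.joint.lam

def pi₂ (s : RWState D) : Bool := s.rdPart.joint.pi

def muS₂ (s : RWState D) : Own := s.rdPart.self

def mu₂ (s : RWState D) : Own := s.rdPart.self + s.rdPart.other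

/-- The number of registrations of the thread. -/
def kappaS (s : RWState D) : ℕ := s.countPart.self

def kappaO (s : RWState D) : ℕ := s.countPart.other

def kappa (s : RWState D) : ℕ := s.countPart.self + s.countPart.other

def iota (s : RWState D) : Bool := s.countPart.joint

def nu₂ (s : RWState D) : Bool := s.sharPart₂.joint.nu

end RWState

namespace RW

variable {D : Type} (P : RWParams D)

/-- The product of the state spaces of the six components, grouped into the one for writers and the one for
readers. -/
noncomputable def space : StateSpace D (((Own × Unit) × Heap D) × ((Own × ℕ) × Unit))
    (((SpinJoint × SharJoint D) × Unit) × ((SpinJoint × Bool) × SharJoint D)) :=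
  (((spinSpace D P.wr).prod (sharSpace P.I)).prod (privSpace D)).prod
    (((spinSpace D P.rd).prod (countSpace D P.ct)).prod (sharSpace P.I))

/-- The coupling of transitions of the six components. -/
def row (a : Rel Own SpinJoint) (b : Rel Unit (SharJoint D)) (c : Rel (Heap D) Unit)
    (d : Rel Own SpinJoint) (e : Rel ℕ Bool) (f : Rel Unit (SharJoint D)) :
    RWState D → RWState D → Prop :=
  couple (((spinSpace D P.wr).prod (sharSpace P.I)).prod (privSpace D))
    (((spinSpace D P.rd).prod (countSpace D P.ct)).prod (sharSpace P.I))
    (couple ((spinSpace D P.wr).prod (sharSpace P.I)) (privSpace D)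
      (couple (spinSpace D P.wr) (sharSpace P.I) a b) c)
    (couple ((spinSpace D P.rd).prod (countSpace D P.ct)) (sharSpace P.I)
      (couple (spinSpace D P.rd) (countSpace D P.ct) d e) f)

abbrev wrSkip : Rel Own SpinJoint := (spinSpace D P.wr).skip

abbrev sharSkip : Rel Unit (SharJoint D) := (sharSpace P.I).skip

abbrev privSkip : Rel (Heap D) Unit := (privSpace D).skip

abbrev rdSkip : Rel Own SpinJoint := (spinSpace D P.rd).skip

abbrev countSkip : Rel ℕ Bool := (countSpace D P.ct).skip

/-- The idle transition of a thread that holds the readers lock. -/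
abbrev rdOwned : Rel Own SpinJoint := (spinSpace D P.rd).idTr fun s => s.self = .own

def wrlockTr := row P (spinLockTr D P.wr .own) (sharSkip P) privSkip
  (rdSkip P) (countSkip P) (sharSkip P)

def wrunlockTr := row P (spinUnlockTr D P.wr .own) (sharSkip P) privSkip
  (rdSkip P) (countSkip P) (sharSkip P)

def freezeTr := row P (spinLockTr D P.wr .free) (sharSkip P) privSkip
  (rdOwned P) (countSkip P) (sharSkip P)

def unfreezeTr := row P (spinUnlockTr D P.wr .free) (sharSkip P) privSkip
  (rdOwned P) (countSkip P) (sharSkip P)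

def rdlockTr := row P (wrSkip P) (sharSkip P) privSkip
  (spinLockTr D P.rd .own) (countSkip P) (sharSkip P)

def rdunlockTr := row P (wrSkip P) (sharSkip P) privSkip
  (spinUnlockTr D P.rd .own) (countSkip P) (sharSkip P)

def incrTr := row P (wrSkip P) (sharSkip P) privSkip
  (rdOwned P) (countIncrTr D P.ct) (sharSkip P)

def decrTr := row P (wrSkip P) (sharSkip P) privSkip
  (rdOwned P) (countDecrTr D P.ct) (sharSkip P)

/-- The transferred heap is the whole shared heap, thus determined by the pre-state. -/
def openTr : RWState D → RWState D → Prop := fun s s' => ∃ h,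
  row P (spinSetTr D P.wr .own false) (sharGiveTr P.I h) (privTakeTr h)
    (rdSkip P) (countSkip P) (sharSkip P) s s'

/-- The transferred heap `h` is chosen by the thread. -/
def closeTr (h : Heap D) := row P (spinSetTr D P.wr .own true) (sharTakeTr P.I h) (privGiveTr h)
  (rdSkip P) (countSkip P) (sharSkip P)

def toreaderTr : RWState D → RWState D → Prop := fun s s' => ∃ h,
  row P (spinSetTr D P.wr .free false) (sharGiveTr P.I h) privSkip
    (rdOwned P) (countSetTr D P.ct true) (sharTakeTr P.I h) s s'

def towriterTr : RWState D → RWState D → Prop := fun s s' => ∃ h,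
  row P (spinSetTr D P.wr .free true) (sharTakeTr P.I h) privSkip
    (rdOwned P) (countSetTr D P.ct false) (sharGiveTr P.I h) s s'

/-- Mutation of a private heap. -/
def writeTr (p : ℕ) (v : Val D) := row P (wrSkip P) (sharSkip P) (privWriteTr p v)
  (rdSkip P) (countSkip P) (sharSkip P)

inductive Base : (RWState D → RWState D → Prop) → Prop where
  | wrlock : Base (wrlockTr P)
  | wrunlock : Base (wrunlockTr P)
  | freeze : Base (freezeTr P)
  | unfreeze : Base (unfreezeTr P)
  | rdlock : Base (rdlockTr P)
  | rdunlock : Base (rdunlockTr P)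
  | incr : Base (incrTr P)
  | decr : Base (decrTr P)
  | opening : Base (openTr P)
  | closing (h : Heap D) : Base (closeTr P h)
  | toreader : Base (toreaderTr P)
  | towriter : Base (towriterTr P)
  | write (p : ℕ) (v : Val D) : Base (writeTr P p v)
  | idle : Base (space P).skip

variable {P}
variable {a : Rel Own SpinJoint} {b : Rel Unit (SharJoint D)} {c : Rel (Heap D) Unit}
  {d : Rel Own SpinJoint} {e : Rel ℕ Bool} {f : Rel Unit (SharJoint D)}

theorem row_isTransition (ha : IsTransition (spinSpace D P.wr) a)
    (hb : IsTransition (sharSpace P.I) b) (hc : IsTransition (privSpace D) c)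
    (hd : IsTransition (spinSpace D P.rd) d) (he : IsTransition (countSpace D P.ct) e)
    (hf : IsTransition (sharSpace P.I) f) : IsTransition (space P) (row P a b c d e f) :=
  couple_isTransition (couple_isTransition (couple_isTransition ha hb) hc)
    (couple_isTransition (couple_isTransition hd he) hf)

theorem row_internal (ha : IsTransition (spinSpace D P.wr) a)
    (hb : IsTransition (sharSpace P.I) b) (hc : IsTransition (privSpace D) c)
    (hd : IsTransition (spinSpace D P.rd) d) (he : IsTransition (countSpace D P.ct) e)
    (hf : IsTransition (sharSpace P.I) f)
    (ia : IsInternal (spinSpace D P.wr) a)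
    (ib : IsInternal (sharSpace P.I) b) (ic : IsInternal (privSpace D) c)
    (i4' : IsInternal (spinSpace D P.rd) d) (ie : IsInternal (countSpace D P.ct) e)
    (i6' : IsInternal (sharSpace P.I) f) : IsInternal (space P) (row P a b c d e f) :=
  couple_internal (couple_isTransition (couple_isTransition ha hb) hc)
    (couple_isTransition (couple_isTransition hd he) hf)
    (couple_internal (couple_isTransition ha hb) hc (couple_internal ha hb ia ib) ic)
    (couple_internal (couple_isTransition hd he) hf (couple_internal hd he i4' ie) i6')

theorem row_elim {s s' : RWState D} (h : row P a b c d e f s s') :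
    (space P).S s ∧ a s.wrPart s'.wrPart ∧ b s.sharPart s'.sharPart ∧ c s.privPart s'.privPart ∧
    d s.rdPart s'.rdPart ∧ e s.countPart s'.countPart ∧ f s.sharPart₂ s'.sharPart₂ :=
  ⟨h.1, h.2.1.2.1.2.1, h.2.1.2.1.2.2.1, h.2.1.2.2.1, h.2.2.1.2.1.2.1, h.2.2.1.2.1.2.2.1,
    h.2.2.1.2.2.1⟩

theorem rdOwned_isTransition : IsTransition (spinSpace D P.rd) (rdOwned P) := by
  refine idTr_isTransition ?_
  intro s p hs h
  simp only [State.oframe, State.sframe] at h ⊢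
  have hd := (spinSpace D P.rd).valid _ hs
  simp only [State.oframe] at hd
  rw [h, Own.own_add_defined, Own.add_eq_free] at hd
  rw [h, hd.1]
  rfl

theorem rdOwned_internal : IsInternal (spinSpace D P.rd) (rdOwned P) :=
  guard_internal (skip_internal _)

theorem open_isTransition : IsTransition (space P) (openTr P) := by
  refine exists_isTransition (fun h => row_isTransition (spinSet_isTransition _ _ _)
    (sharGive_isTransition _ _) (privTake_isTransition _) (skip_isTransition _)
    (skip_isTransition _) (skip_isTransition _)) ?_
  intro i j s s₁ s₂ h₁ h₂
  exact (row_elim h₁).2.2.1.2.2.2.1.trans (row_elim h₂).2.2.1.2.2.2.1.symm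

theorem close_isTransition (h : Heap D) : IsTransition (space P) (closeTr P h) :=
  row_isTransition (spinSet_isTransition _ _ _) (sharTake_isTransition _ _)
    (privGive_isTransition _) (skip_isTransition _) (skip_isTransition _) (skip_isTransition _)

theorem toreader_isTransition : IsTransition (space P) (toreaderTr P) := by
  refine exists_isTransition (fun h => row_isTransition (spinSet_isTransition _ _ _)
    (sharGive_isTransition _ _) (skip_isTransition _) rdOwned_isTransition
    (countSet_isTransition _ _) (sharTake_isTransition _ _)) ?_
  intro i j s s₁ s₂ h₁ h₂
  exact (row_elim h₁).2.2.1.2.2.2.1.trans (row_elim h₂).2.2.1.2.2.2.1.symm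

theorem towriter_isTransition : IsTransition (space P) (towriterTr P) := by
  refine exists_isTransition (fun h => row_isTransition (spinSet_isTransition _ _ _)
    (sharTake_isTransition _ _) (skip_isTransition _) rdOwned_isTransition
    (countSet_isTransition _ _) (sharGive_isTransition _ _)) ?_
  intro i j s s₁ s₂ h₁ h₂
  exact (row_elim h₁).2.2.2.2.2.2.2.2.2.1.trans (row_elim h₂).2.2.2.2.2.2.2.2.2.1.symm

theorem base_isTransition {t : RWState D → RWState D → Prop} (h : Base P t) :
    IsTransition (space P) t := by
  have k1 := fun C : StateSpace D Own SpinJoint => skip_isTransition C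
  have k2 := fun C : StateSpace D Unit (SharJoint D) => skip_isTransition C
  have k3 := fun C : StateSpace D (Heap D) Unit => skip_isTransition C
  have k4 := fun C : StateSpace D ℕ Bool => skip_isTransition C
  cases h with
  | wrlock => exact row_isTransition (spinLock_isTransition _ _) (k2 _) (k3 _) (k1 _) (k4 _) (k2 _)
  | wrunlock =>
    exact row_isTransition (spinUnlock_isTransition _ _) (k2 _) (k3 _) (k1 _) (k4 _) (k2 _)
  | freeze =>
    exact row_isTransition (spinLock_isTransition _ _) (k2 _) (k3 _) rdOwned_isTransition (k4 _)
      (k2 _)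
  | unfreeze =>
    exact row_isTransition (spinUnlock_isTransition _ _) (k2 _) (k3 _) rdOwned_isTransition (k4 _)
      (k2 _)
  | rdlock => exact row_isTransition (k1 _) (k2 _) (k3 _) (spinLock_isTransition _ _) (k4 _) (k2 _)
  | rdunlock =>
    exact row_isTransition (k1 _) (k2 _) (k3 _) (spinUnlock_isTransition _ _) (k4 _) (k2 _)
  | incr =>
    exact row_isTransition (k1 _) (k2 _) (k3 _) rdOwned_isTransition (countIncr_isTransition _)
      (k2 _)
  | decr =>
    exact row_isTransition (k1 _) (k2 _) (k3 _) rdOwned_isTransition (countDecr_isTransition _)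
      (k2 _)
  | opening => exact open_isTransition
  | closing h => exact close_isTransition h
  | toreader => exact toreader_isTransition
  | towriter => exact towriter_isTransition
  | write p v => exact row_isTransition (k1 _) (k2 _) (privWrite_isTransition _ _) (k1 _) (k4 _) (k2 _)
  | idle => exact skip_isTransition _

theorem flat_eq (s : RWState D) : (space P).flat s =
    ((Heap.pts P.wr (.bool s.wrPart.joint.lam) + s.sharPart.joint.heap) +
      (s.privPart.self + s.privPart.other)) +
    ((Heap.pts P.rd (.bool s.rdPart.joint.lam) +
      Heap.pts P.ct (.nat (s.countPart.self + s.countPart.other))) + s.sharPart₂.joint.heap) := rfl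

theorem base_internal {t : RWState D → RWState D → Prop} (h : Base P t) :
    IsInternal (space P) t := by
  have k1 := fun C : StateSpace D Own SpinJoint => skip_isTransition C
  have k2 := fun C : StateSpace D Unit (SharJoint D) => skip_isTransition C
  have k3 := fun C : StateSpace D (Heap D) Unit => skip_isTransition C
  have k4 := fun C : StateSpace D ℕ Bool => skip_isTransition C
  have i1 := fun C : StateSpace D Own SpinJoint => skip_internal C
  have i2 := fun C : StateSpace D Unit (SharJoint D) => skip_internal C
  have i3 := fun C : StateSpace D (Heap D) Unit => skip_internal C
  have i4 := fun C : StateSpace D ℕ Bool => skip_internal C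
  cases h with
  | wrlock =>
    exact row_internal (spinLock_isTransition _ _) (k2 _) (k3 _) (k1 _) (k4 _) (k2 _)
      (spin_internal _ _) (i2 _) (i3 _) (i1 _) (i4 _) (i2 _)
  | wrunlock =>
    exact row_internal (spinUnlock_isTransition _ _) (k2 _) (k3 _) (k1 _) (k4 _) (k2 _)
      (spin_internal _ _) (i2 _) (i3 _) (i1 _) (i4 _) (i2 _)
  | freeze =>
    exact row_internal (spinLock_isTransition _ _) (k2 _) (k3 _) rdOwned_isTransition (k4 _)
      (k2 _) (spin_internal _ _) (i2 _) (i3 _) rdOwned_internal (i4 _) (i2 _)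
  | unfreeze =>
    exact row_internal (spinUnlock_isTransition _ _) (k2 _) (k3 _) rdOwned_isTransition (k4 _)
      (k2 _) (spin_internal _ _) (i2 _) (i3 _) rdOwned_internal (i4 _) (i2 _)
  | rdlock =>
    exact row_internal (k1 _) (k2 _) (k3 _) (spinLock_isTransition _ _) (k4 _) (k2 _)
      (i1 _) (i2 _) (i3 _) (spin_internal _ _) (i4 _) (i2 _)
  | rdunlock =>
    exact row_internal (k1 _) (k2 _) (k3 _) (spinUnlock_isTransition _ _) (k4 _) (k2 _)
      (i1 _) (i2 _) (i3 _) (spin_internal _ _) (i4 _) (i2 _)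
  | incr =>
    exact row_internal (k1 _) (k2 _) (k3 _) rdOwned_isTransition (countIncr_isTransition _)
      (k2 _) (i1 _) (i2 _) (i3 _) rdOwned_internal (count_internal _ _) (i2 _)
  | decr =>
    exact row_internal (k1 _) (k2 _) (k3 _) rdOwned_isTransition (countDecr_isTransition _)
      (k2 _) (i1 _) (i2 _) (i3 _) rdOwned_internal (count_internal _ _) (i2 _)
  | write p v =>
    exact row_internal (k1 _) (k2 _) (privWrite_isTransition _ _) (k1 _) (k4 _) (k2 _)
      (i1 _) (i2 _) (privWrite_internal _ _) (i1 _) (i4 _) (i2 _)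
  | idle => exact skip_internal _
  | opening =>
    rintro s s' ⟨h, hr⟩
    obtain ⟨-, ⟨-, -, -, a1, -, -, a2, -, -⟩, ⟨-, -, -, b1, -, b2, -⟩, ⟨-, -, c1, c2⟩, ⟨-, d1⟩,
      ⟨-, e1⟩, ⟨-, f1⟩⟩ := row_elim hr
    rw [flat_eq, flat_eq, a1, a2, ← b1, b2, c1, c2, d1, e1, f1]
    congr 2
    abel
  | closing h =>
    rintro s s' hr
    obtain ⟨-, ⟨-, -, -, a1, -, -, a2, -, -⟩, ⟨b0, -, -, -, b1, b2, -⟩, ⟨-, -, c1, c2⟩, ⟨-, d1⟩,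
      ⟨-, e1⟩, ⟨-, f1⟩⟩ := row_elim hr
    have b3 : (RWState.sharPart s).joint.heap = 0 := by
      have := b0.2
      rwa [b1, if_neg (by decide)] at this
    rw [flat_eq, flat_eq, a1, a2, b2, b3, c1, c2, d1, e1, f1]
    congr 2
    abel
  | toreader =>
    rintro s s' ⟨h, hr⟩
    obtain ⟨-, ⟨-, -, -, a1, -, -, a2, -, -⟩, ⟨-, -, -, b1, -, b2, -⟩, ⟨-, c1⟩, ⟨-, -, d1⟩,
      ⟨-, -, -, e1, e2, -⟩, ⟨f0, -, -, -, f1, f2, -⟩⟩ := row_elim hr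
    have f3 : (RWState.sharPart₂ s).joint.heap = 0 := by
      have := f0.2
      rwa [f1, if_neg (by decide)] at this
    rw [flat_eq, flat_eq, a1, a2, ← b1, b2, c1, d1, e1, e2, f2, f3]
    congr 1
    abel
  | towriter =>
    rintro s s' ⟨h, hr⟩
    obtain ⟨-, ⟨-, -, -, a1, -, -, a2, -, -⟩, ⟨f0, -, -, -, f1, f2, -⟩, ⟨-, c1⟩, ⟨-, -, d1⟩,
      ⟨-, -, -, e1, e2, -⟩, ⟨-, -, -, b1, -, b2, -⟩⟩ := row_elim hr
    have f3 : (RWState.sharPart s).joint.heap = 0 := by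
      have := f0.2
      rwa [f1, if_neg (by decide)] at this
    rw [flat_eq, flat_eq, a1, a2, ← b1, b2, c1, d1, e1, e2, f2, f3]
    congr 1
    abel

variable (P) in
/-- The coupled product of the six components; all its transitions are internal. -/
noncomputable def preRWLock : Resource D where
  U := _
  T := _
  space := space P
  int := guardClosure (space P) {t | Base P t}
  ext := ∅
  int_trans := by
    rintro t ⟨h, t₀, ht, G, rfl⟩
    exact ⟨h, guard_internal (base_internal ht)⟩
  ext_trans t ht := ht.elim

/-- The invariant that ties the components together. -/
def inv (s : RWState D) : Prop :=
  s.pi = s.nu ∧ s.iota = s.nu₂ ∧ s.pi₂ = true ∧ (s.lam₂ = true → s.mu₂ = .own) ∧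
  (s.nu₂ = true ↔ s.lam = true ∧ s.mu = .free ∧ s.nu = false)

theorem inv_global : Global (inv (D := D)) := by
  intro s p
  have h1 : RWState.mu (s.sframe p) = RWState.mu (s.oframe p) := add_assoc _ _ _
  have h2 : RWState.mu₂ (s.sframe p) = RWState.mu₂ (s.oframe p) := add_assoc _ _ _
  unfold inv
  rw [h1, h2]
  exact Iff.rfl

theorem inv_inductive : (preRWLock P).Inductive inv := by
  rintro t ⟨-, t₀, ht, G, rfl⟩ s s' ⟨-, h⟩ hi
  simp only [inv, RWState.pi, RWState.nu, RWState.iota, RWState.nu₂, RWState.pi₂, RWState.lam₂,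
    RWState.mu₂, RWState.lam, RWState.mu] at hi ⊢
  cases ht with
  | wrlock =>
    obtain ⟨-, ⟨x1, x2, x3, a1, a2, a3, a4⟩, ⟨-, b⟩, ⟨-, c⟩, ⟨-, d⟩, ⟨-, e⟩, ⟨-, f⟩⟩ := row_elim h
    rw [b, d, e, f, a2, a3, a4, x3]
    have m := x1.2.2 a1
    have := (Own.add_eq_free.1 m.1).2
    rw [this]
    simp_all [Own.add_free]
  | wrunlock =>
    obtain ⟨-, ⟨x1, x2, x3, a1, a2, a3, a4, a5⟩, ⟨-, b⟩, ⟨-, c⟩, ⟨-, d⟩, ⟨-, e⟩, ⟨-, f⟩⟩ := row_elim h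
    rw [b, d, e, f, a5]
    have m := x2.2.2 a5
    simp_all [Own.add_free]
  | freeze =>
    obtain ⟨-, ⟨x1, x2, x3, a1, a2, a3, a4⟩, ⟨-, b⟩, ⟨-, c⟩, ⟨-, -, d⟩, ⟨-, e⟩, ⟨-, f⟩⟩ := row_elim h
    rw [b, d, e, f, a2, a3, a4, x3]
    have m := x1.2.2 a1
    simp_all
  | unfreeze =>
    obtain ⟨-, ⟨x1, x2, x3, a1, a2, a3, a4, a5⟩, ⟨-, b⟩, ⟨-, c⟩, ⟨-, -, d⟩, ⟨-, e⟩, ⟨-, f⟩⟩ :=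
      row_elim h
    rw [b, d, e, f, a5]
    have m := x2.2.2 a5
    simp_all
  | rdlock =>
    obtain ⟨-, ⟨-, a⟩, ⟨-, b⟩, ⟨-, c⟩, ⟨x1, x2, x3, d1, d2, d3, d4⟩, ⟨-, e⟩, ⟨-, f⟩⟩ := row_elim h
    rw [a, b, e, f, d2, d3, d4, x3]
    have m := x1.2.2 d1
    have := (Own.add_eq_free.1 m.1).2
    rw [this]
    simp_all [Own.add_free]
  | rdunlock =>
    obtain ⟨-, ⟨-, a⟩, ⟨-, b⟩, ⟨-, c⟩, ⟨x1, x2, x3, d1, d2, d3, d4, d5⟩, ⟨-, e⟩, ⟨-, f⟩⟩ := row_elim h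
    rw [a, b, e, f, d5]
    have m := x2.2.2 d5
    simp_all
  | incr =>
    obtain ⟨-, ⟨-, a⟩, ⟨-, b⟩, ⟨-, c⟩, ⟨-, -, d⟩, ⟨x1, x2, x3, e1, e2⟩, ⟨-, f⟩⟩ := row_elim h
    rw [a, b, d, f]
    have m := x2.2 (by omega)
    rw [m]
    rw [e1] at hi
    exact hi
  | decr =>
    obtain ⟨-, ⟨-, a⟩, ⟨-, b⟩, ⟨-, c⟩, ⟨-, -, d⟩, ⟨x1, x2, x3, e1, e2⟩, ⟨-, f⟩⟩ := row_elim h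
    rw [a, b, d, f, e2]
    have m := x1.2 (by omega)
    rw [m] at hi
    exact hi
  | opening =>
    obtain ⟨k, h⟩ := h
    obtain ⟨-, ⟨x1, x2, x3, a1, a2, a3, a4, a5, a6⟩, ⟨-, -, -, b1, b2, b3, b4⟩, -, ⟨-, d⟩, ⟨-, e⟩,
      ⟨-, f⟩⟩ := row_elim h
    rw [d, e, f, a4, a5, a6, b4, x3, a3]
    simp_all [Own.add_free]
  | closing k =>
    obtain ⟨-, ⟨x1, x2, x3, a1, a2, a3, a4, a5, a6⟩, ⟨-, -, -, b1, b2, b3, b4⟩, -, ⟨-, d⟩, ⟨-, e⟩,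
      ⟨-, f⟩⟩ := row_elim h
    rw [d, e, f, a4, a5, a6, b4, x3, a3]
    simp_all [Own.add_free]
  | toreader =>
    obtain ⟨k, h⟩ := h
    obtain ⟨-, ⟨x1, x2, x3, a1, a2, a3, a4, a5, a6⟩, ⟨-, -, -, b1, b2, b3, b4⟩, -, ⟨-, -, d⟩,
      ⟨-, -, -, e1, e2, e3⟩, ⟨-, -, -, f1, f2, f3, f4⟩⟩ := row_elim h
    rw [d, e3, a4, a5, a6, b4, f4, x3, a3]
    simp_all [Own.add_free]
  | towriter =>
    obtain ⟨k, h⟩ := h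
    obtain ⟨-, ⟨x1, x2, x3, a1, a2, a3, a4, a5, a6⟩, ⟨-, -, -, b1, b2, b3, b4⟩, -, ⟨-, -, d⟩,
      ⟨-, -, -, e1, e2, e3⟩, ⟨-, -, -, f1, f2, f3, f4⟩⟩ := row_elim h
    rw [d, e3, a4, a5, a6, b4, f4, x3, a3]
    simp_all [Own.add_free]
  | write p v =>
    obtain ⟨-, ⟨-, a⟩, ⟨-, b⟩, -, ⟨-, d⟩, ⟨-, e⟩, ⟨-, f⟩⟩ := row_elim h
    rw [a, b, d, e, f]
    exact hi
  | idle =>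
    obtain ⟨-, rfl⟩ := h
    exact hi

variable (P) in
/-- The readers/writers lock. -/
noncomputable def rwLock : Resource D := (preRWLock P).restrict inv inv_global inv_inductive

/-! ### Lifting the locking procedure -/

variable (P) in
/-- The image of a transition of the spin lock of the readers: all other components idle. -/
def rdLift (t : Rel Own SpinJoint) : RWState D → RWState D → Prop :=
  row P (wrSkip P) (sharSkip P) privSkip t (countSkip P) (sharSkip P)

theorem rdLift_mem {t : Rel Own SpinJoint} (ht : t ∈ (spinRes D P.rd).int) :
    rdLift P t ∈ (preRWLock P).int := by
  obtain ⟨h, t₀, h₀, G, rfl⟩ := ht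
  refine ⟨row_isTransition (skip_isTransition _) (skip_isTransition _) (skip_isTransition _) h
    (skip_isTransition _) (skip_isTransition _), rdLift P t₀, ?_, fun s => G (RWState.rdPart s), ?_⟩
  · rcases h₀ with rfl | rfl | rfl
    · exact Base.rdlock
    · exact Base.rdunlock
    · have e : rdLift P (rdSkip P) = (space P).skip := by
        funext s s'
        apply propext
        constructor
        · intro h
          obtain ⟨hS, ⟨-, a⟩, ⟨-, b⟩, ⟨-, c⟩, ⟨-, d⟩, ⟨-, e⟩, ⟨-, f⟩⟩ := row_elim h
          refine ⟨hS, ?_⟩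
          simp only [RWState.wrPart, RWState.sharPart, RWState.privPart, RWState.rdPart,
            RWState.countPart, RWState.sharPart₂, State.fst, State.snd, State.mk.injEq] at a b c d e f
          refine State.ext ?_ ?_ ?_ <;> simp only [Prod.ext_iff] <;> tauto
        · rintro ⟨hS, rfl⟩
          have h1 := hS.1
          have h2 := hS.2.1
          exact ⟨hS, ⟨h1, ⟨h1.1, ⟨h1.1.1, rfl⟩, ⟨h1.1.2.1, rfl⟩, h1.1.2.2⟩, ⟨h1.2.1, rfl⟩, h1.2.2⟩,
            ⟨h2, ⟨h2.1, ⟨h2.1.1, rfl⟩, ⟨h2.1.2.1, rfl⟩, h2.1.2.2⟩, ⟨h2.2.1, rfl⟩, h2.2.2⟩, hS.2.2⟩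
      exact e ▸ Base.idle
  · funext s s'
    apply propext
    constructor
    · rintro ⟨a0, a1, ⟨b0, ⟨c0, ⟨c1, c2⟩, c3⟩, b1⟩, a2⟩
      exact ⟨c1, a0, a1, ⟨b0, ⟨c0, c2, c3⟩, b1⟩, a2⟩
    · rintro ⟨c1, a0, a1, ⟨b0, ⟨c0, c2, c3⟩, b1⟩, a2⟩
      exact ⟨a0, a1, ⟨b0, ⟨c0, ⟨c1, c2⟩, c3⟩, b1⟩, a2⟩

theorem rdPart_step {t : RWState D → RWState D → Prop} (ht : t ∈ (preRWLock P).int)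
    {s s' : RWState D} (h : t s s') : RWState.rdPart s' = RWState.rdPart s ∨
      spinLockTr D P.rd .own (RWState.rdPart s) (RWState.rdPart s') ∨
      spinUnlockTr D P.rd .own (RWState.rdPart s) (RWState.rdPart s') := by
  obtain ⟨-, t₀, h₀, G, rfl⟩ := ht
  have h := h.2
  cases h₀ with
  | rdlock => exact Or.inr (Or.inl (row_elim h).2.2.2.2.1)
  | rdunlock => exact Or.inr (Or.inr (row_elim h).2.2.2.2.1)
  | wrlock => exact Or.inl (row_elim h).2.2.2.2.1.2
  | wrunlock => exact Or.inl (row_elim h).2.2.2.2.1.2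
  | closing k => exact Or.inl (row_elim h).2.2.2.2.1.2
  | write p v => exact Or.inl (row_elim h).2.2.2.2.1.2
  | freeze => exact Or.inl (row_elim h).2.2.2.2.1.2.2
  | unfreeze => exact Or.inl (row_elim h).2.2.2.2.1.2.2
  | incr => exact Or.inl (row_elim h).2.2.2.2.1.2.2
  | decr => exact Or.inl (row_elim h).2.2.2.2.1.2.2
  | opening =>
    obtain ⟨k, h⟩ := h
    exact Or.inl (row_elim h).2.2.2.2.1.2
  | toreader =>
    obtain ⟨k, h⟩ := h
    exact Or.inl (row_elim h).2.2.2.2.1.2.2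
  | towriter =>
    obtain ⟨k, h⟩ := h
    exact Or.inl (row_elim h).2.2.2.2.1.2.2
  | idle => exact Or.inl (by rw [h.2])

variable (P) in
/-- The morphism from the spin lock of the readers to the coupled product. -/
noncomputable def rdMorphism : Morphism (spinRes D P.rd) (preRWLock P) where
  rel _ sv sw := sv = RWState.rdPart sw ∧ (space P).S sw
  tr _ t := ⟨rdLift P t.1, rdLift_mem t.2⟩
  rel_valid := by
    rintro _ sv sw ⟨rfl, h⟩
    exact ⟨h.2.1.1.1, h⟩
  sim_int := by
    rintro _ ⟨t, ht⟩ sv sv' sw h ⟨rfl, hs⟩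
    obtain ⟨htr, hin⟩ := (spinRes D P.rd).int_trans t ht
    have hl := (preRWLock P).int_trans _ (rdLift_mem ht)
    have k1 := fun C : StateSpace D Own SpinJoint => skip_isTransition C
    have k2 := fun C : StateSpace D Unit (SharJoint D) => skip_isTransition C
    have k3 := fun C : StateSpace D (Heap D) Unit => skip_isTransition C
    have k4 := fun C : StateSpace D ℕ Bool => skip_isTransition C
    have i1 := fun C : StateSpace D Own SpinJoint => skip_internal C
    have i2 := fun C : StateSpace D Unit (SharJoint D) => skip_internal C
    have i3 := fun C : StateSpace D (Heap D) Unit => skip_internal C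
    have i4 := fun C : StateSpace D ℕ Bool => skip_internal C
    let sw' : RWState D := State.pair (State.fst sw)
      (State.pair (State.pair sv' (RWState.countPart sw)) (RWState.sharPart₂ sw))
    have hstep : rdLift P t sw sw' := by
      have h1 := hs.1
      have h2 := hs.2.1
      refine couple_enabled (couple_isTransition (couple_isTransition (k1 _) (k2 _)) (k3 _))
        (couple_isTransition (couple_isTransition htr (k4 _)) (k2 _))
        (couple_internal (couple_isTransition (k1 _) (k2 _)) (k3 _)
          (couple_internal (k1 _) (k2 _) (i1 _) (i2 _)) (i3 _))
        (couple_internal (couple_isTransition htr (k4 _)) (k2 _)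
          (couple_internal htr (k4 _) hin (i4 _)) (i2 _)) hs ?_ ?_
      · exact ⟨h1, ⟨h1.1, ⟨h1.1.1, rfl⟩, ⟨h1.1.2.1, rfl⟩, h1.1.2.2⟩, ⟨h1.2.1, rfl⟩, h1.2.2⟩
      · refine couple_enabled (couple_isTransition htr (k4 _)) (k2 _)
          (couple_internal htr (k4 _) hin (i4 _)) (i2 _) h2 ?_ ⟨h2.2.1, rfl⟩
        exact couple_enabled htr (k4 _) hin (i4 _) h2.1 h ⟨h2.1.2.1, rfl⟩
    exact ⟨(), sw', hstep, rfl, hl.1.preserves _ _ hstep hs⟩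
  sim_other := by
    rintro _ sv sw sw' h ⟨rfl, hs⟩
    refine ⟨RWState.rdPart sw', ?_, rfl, Resource.osteps_S h hs⟩
    clear hs
    induction h with
    | refl => exact Relation.ReflTransGen.refl
    | tail _ h ih =>
      obtain ⟨t, ht | ht, h⟩ := h
      · rcases rdPart_step ht h with h | h | h
        · have e := congrArg State.transpose h
          rw [show RWState.rdPart _ = _ from e]
          exact ih
        · exact ih.tail ⟨_, Or.inl (subset_guardClosure (spinLock_isTransition _ _) (Or.inl rfl)), h⟩
        · exact ih.tail ⟨_, Or.inl (subset_guardClosure (spinUnlock_isTransition _ _)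
            (Or.inr (Or.inl rfl))), h⟩
      · exact ht.elim
  functional := by
    rintro _ sv₁ sv₂ sw ⟨rfl, _⟩ ⟨rfl, _⟩
    rfl
  frame := by
    refine ⟨fun p => p.2.1.1, ?_⟩
    rintro _ sv sw p ⟨rfl, h⟩
    exact ⟨RWState.rdPart sw, rfl, rfl, ((space P).global sw p).2 h⟩
  other_fixed := by
    rintro _ _ sv sv' sw sw' ⟨rfl, _⟩ ⟨rfl, _⟩ h
    exact congrArg (fun x => x.2.1.1) h
  index_inj := fun _ _ _ _ _ _ _ => rfl

variable (P) in
/-- The locking of the readers lock: the lifting of the locking procedure of the spin lock. -/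
noncomputable def rdlock : ST (rwLock P) Unit :=
  ST.morph (restrictMorphism (preRWLock P) inv inv_global inv_inductive) ()
    (ST.morph (rdMorphism P) () (lock D P.rd))

/-! ### Actions and programs -/

theorem base_mem {t : RWState D → RWState D → Prop} (h : Base P t) : t ∈ (rwLock P).int :=
  subset_guardClosure (base_isTransition h) h

theorem kappa_global (s : RWState D) (p : ((Own × Unit) × Heap D) × ((Own × ℕ) × Unit)) :
    RWState.kappa (s.sframe p) = RWState.kappa (s.oframe p) := add_assoc _ _ _

variable (P) in
/-- Reading of the counter. -/
noncomputable def readcntAct : Action (rwLock P) ℕ where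
  rel x := (space P).idTr fun s => RWState.kappa s = x
  internal _ := ⟨idTr_isTransition fun s p _ h => (kappa_global s p).trans h, _, Base.idle, _, rfl⟩
  functional _ _ _ _ _ h₁ h₂ := h₁.1.symm.trans h₂.1

variable (P) in
/-- One attempt of a reader to take the writers lock, returning whether it was successful; it fails only if the
lock is taken. -/
noncomputable def tryfreezeAct : Action (rwLock P) Bool where
  rel b := if b then freezeTr P else (space P).idTr fun s => RWState.lam s = true
  internal b := by
    cases b
    · exact ⟨idTr_isTransition fun s p _ h => h, _, Base.idle, _, rfl⟩
    · exact base_mem Base.freeze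
  functional := by
    intro v₁ v₂ s s₁ s₂ h₁ h₂
    cases v₁ <;> cases v₂ <;> first | rfl | skip
    · exact absurd (h₁.1.symm.trans (row_elim h₂).2.1.2.2.2.1) (by decide)
    · exact absurd (h₂.1.symm.trans (row_elim h₁).2.1.2.2.2.1) (by decide)

/-- The action without a return value that takes a basic transition. -/
noncomputable def baseAct {t : RWState D → RWState D → Prop} (h : Base P t) :
    Action (rwLock P) Unit where
  rel _ := t
  internal _ := base_mem h
  functional _ _ _ _ _ _ _ := rfl

theorem guard_mem {t : RWState D → RWState D → Prop} (h : Base P t)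
    (hS : ∀ s s', t s s' → (space P).S s) (x : ℕ) :
    guard (fun s => x = RWState.kappa s) t ∈ (rwLock P).int :=
  ⟨guard_isTransition (base_isTransition h) hS fun s p _ e => e.trans (kappa_global s p).symm,
    t, h, _, rfl⟩

variable (P) in
/-- Writing of `x + 1` into the counter, provided that it contains `x`. -/
noncomputable def incrAct (x : ℕ) : Action (rwLock P) Unit where
  rel _ := guard (fun s => x = RWState.kappa s) (incrTr P)
  internal _ := guard_mem Base.incr (fun _ _ h => (row_elim h).1) x
  functional _ _ _ _ _ _ _ := rfl

variable (P) in
/-- Writing of `x - 1` into the counter, provided that it contains `x`. -/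
noncomputable def decrAct (x : ℕ) : Action (rwLock P) Unit where
  rel _ := guard (fun s => x = RWState.kappa s) (decrTr P)
  internal _ := guard_mem Base.decr (fun _ _ h => (row_elim h).1) x
  functional _ _ _ _ _ _ _ := rfl

variable (P)

noncomputable def toreaderAct : Action (rwLock P) Unit := baseAct Base.toreader

noncomputable def towriterAct : Action (rwLock P) Unit := baseAct Base.towriter

noncomputable def unfreezeAct : Action (rwLock P) Unit := baseAct Base.unfreeze

noncomputable def rdunlockAct : Action (rwLock P) Unit := baseAct Base.rdunlock

/-- The locking loop of a reader over the writers lock. -/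
noncomputable def freeze : ST (rwLock P) Unit :=
  ST.fix fun loop => (ST.atomic (tryfreezeAct P)).bind fun b => if b then ST.ret () else loop

/-- The first reader transfers the protected heap from the writers to the readers. -/
noncomputable def acquire (x : ℕ) : ST (rwLock P) Unit :=
  if x = 0 then (freeze P).bind fun _ => ST.atomic (toreaderAct P) else ST.ret ()

/-- The last reader transfers the protected heap from the readers to the writers. -/
noncomputable def release (x : ℕ) : ST (rwLock P) Unit :=
  if x = 1 then (ST.atomic (towriterAct P)).bind fun _ => ST.atomic (unfreezeAct P) else ST.ret ()

noncomputable def prologue : ST (rwLock P) Unit :=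
  (rdlock P).bind fun _ => (ST.atomic (readcntAct P)).bind fun x => (acquire P x).bind fun _ =>
    (ST.atomic (incrAct P x)).bind fun _ => ST.atomic (rdunlockAct P)

noncomputable def epilogue : ST (rwLock P) Unit :=
  (rdlock P).bind fun _ => (ST.atomic (readcntAct P)).bind fun x =>
    (ST.atomic (decrAct P x)).bind fun _ => (release P x).bind fun _ => ST.atomic (rdunlockAct P)

end RW

end FCSL

namespace FCSL

/-! ### Program logic: interference, the `after` modality, and the rules for programs -/

section Logic

variable {D : Type} {V W : Resource D} {A B X : Type}

/-! The proof rests on exclusive ownership of the readers lock. Environment steps never change self,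
so assertions on `σ_s`, `κ_s` and `μ_{s2}` are stable for free. If `μ_{s2} = own`, the environment
cannot hold `own` as well, since `own + own` is undefined. Hence every environment transition that
requires this ownership is disabled, and these include all that change the counter. So the whole
counter component is constant (`osteps_owned`), and `x = c + κ_o` stays true from the reading of the
counter to its update, even across the `freeze` loop. In the same way, a writers lock with `λ` and
`μ = free` is out of reach: locking needs `¬λ`, and the writers' other transitions need `own`.

The actions are enabled because of the invariant. After freezing, `π = ν` says that the first shared
heap is present and the last clause says that the second is absent, so the first reader can transfer
it. A later reader sees `κ > 0`, which forces `ι`. The last reader has `ι = ν₂`, and `ν₂` yields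
exactly the state of the writers lock that the transfer back requires, whoever froze it.
Disjointness of heaps survives because the components either keep their pointers or merely exchange
a heap (`row_enabled`, `toreader_enabled`, `towriter_enabled`).

The rest is a program logic. `after` is treated as a greatest fixed point (`after_elim`,
`after_coind`), which gives rules for actions, sequencing, lifting along morphisms and recursion.
The rule for lifting carries a stable assertion `J` on the larger resource; this is how `σ_s` and
`κ_s` survive `rdlock`, although the spin lock knows nothing of them. -/

theorem Resource.ostep_self {s s' : V.St} (h : V.ostep s s') : s'.self = s.self := by
  obtain ⟨t, ht, h⟩ := h
  have htr : IsTransition V.space t := ht.elim (fun a => (V.int_trans t a).1) (V.ext_trans t)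
  exact (htr.other_fixed _ _ h).symm

/-- An other-step is a transition with self and other exchanged, so `other_fixed` protects the self
of the observing thread. Stability of every assertion about self alone comes from here. -/
theorem Resource.osteps_self {s s' : V.St} (h : V.osteps s s') : s'.self = s.self := by
  induction h with
  | refl => rfl
  | tail _ h ih => exact (ostep_self h).trans ih

/-- The recorded transition is the one taken at the outermost level, so under a morphism the image
already accounts for the change of state and no induction into the inner tree is needed. -/
theorem Fire.transition {T T' : ActTree V A} {π : Path} {t : V.Int} {s s' : V.St}
    (h : Fire T π t s s' T') : t.1 s s' := by
  induction h with
  | act a v h => exact h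
  | seqStep _ _ ih => exact ih
  | parL _ _ _ ih => exact ih
  | parR _ _ _ ih => exact ih
  | morphStep _ _ _ _ _ _ h => exact h

theorem Step.preserves {T T' : ActTree V A} {π : Path} {s s' : V.St} (h : Step s T π s' T')
    (hs : V.S s) : V.S s' := by
  rcases h with ⟨-, rfl⟩ | ⟨t, h⟩
  · exact hs
  · exact (V.int_trans t.1 t.2).1.preserves _ _ h.transition hs

/-- Unfolding half of the fixed-point reading of `after`: the empty schedule gives the
postcondition, a schedule of length one gives safety, and the schedules that start with `π` give the
rest. -/
theorem after_elim {T : ActTree V A} {Q : A → V.St → Prop} {s s₂ : V.St} (h : after T Q s)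
    (ho : V.osteps s s₂) : (∀ v, T = .ret v → Q v s₂) ∧ ∀ π, Safe T π s₂ ∧
      ∀ s₃ T', Step s₂ T π s₃ T' → after T' Q s₃ :=
  ⟨h [] s₂ ho, fun π => ⟨(h [π] s₂ ho).1, fun s₃ T' hs ζ => (h (π :: ζ) s₂ ho).2.2 s₃ T' hs⟩⟩

/-- The coinduction principle for `after`. -/
theorem after_coind {Q : A → V.St → Prop} (R : ActTree V A → V.St → Prop)
    (hR : ∀ T s, R T s → ∀ s₂, V.osteps s s₂ → (∀ v, T = .ret v → Q v s₂) ∧ ∀ π, Safe T π s₂ ∧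
      ∀ s₃ T', Step s₂ T π s₃ T' → R T' s₃ ∨ after T' Q s₃)
    {T : ActTree V A} {s : V.St} (h : R T s) : after T Q s := by
  intro ζ
  -- Schedules are finite, so the coinduction is an induction on their length. The alternative
  -- `after T' Q s₃` lets the argument leave `R` as soon as the remaining tree is already verified.
  induction ζ generalizing T s with
  | nil => exact fun s₂ ho => (hR T s h s₂ ho).1
  | cons π ζ ih =>
    intro s₂ ho
    obtain ⟨h₁, h₂⟩ := hR T s h s₂ ho
    exact ⟨(h₂ π).1, h₁, fun s₃ T' hs => ((h₂ π).2 s₃ T' hs).elim ih fun ha => ha ζ⟩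

/-- The implication is only available in valid states, so validity is made part of the coinduction
relation. -/
theorem after_mono {T : ActTree V A} {Q Q' : A → V.St → Prop} {s : V.St} (hs : V.S s)
    (h : after T Q s) (hQ : ∀ v s', V.S s' → Q v s' → Q' v s') : after T Q' s := by
  refine after_coind (fun T s => V.S s ∧ after T Q s) ?_ ⟨hs, h⟩
  rintro T s ⟨hs, h⟩ s₂ ho
  have hs₂ := Resource.osteps_S ho hs
  obtain ⟨h₁, h₂⟩ := after_elim h ho
  exact ⟨fun v hv => hQ v s₂ hs₂ (h₁ v hv), fun π => ⟨(h₂ π).1, fun s₃ T' hst =>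
    Or.inl ⟨hst.preserves hs₂, (h₂ π).2 s₃ T' hst⟩⟩⟩

/-- An unfinished tree has no redex and is not a value, so nothing can go wrong. This is where
partial correctness enters: truncated approximations satisfy everything. -/
theorem after_unfinished (Q : A → V.St → Prop) (s : V.St) : after .unfinished Q s := by
  refine after_coind (fun T _ => T = .unfinished) ?_ rfl
  rintro T s rfl s₂ -
  refine ⟨fun v hv => (by cases hv), fun π => ⟨fun h => (by cases h), ?_⟩⟩
  rintro s₃ T' (⟨h, -⟩ | ⟨t, h⟩) <;> cases h

theorem after_ret {v : A} {Q : A → V.St → Prop} {s : V.St}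
    (h : ∀ s', V.osteps s s' → Q v s') : after (.ret v) Q s := by
  refine after_coind (fun T s => T = .ret v ∧ ∀ s', V.osteps s s' → Q v s') ?_ ⟨rfl, h⟩
  rintro T s ⟨rfl, h⟩ s₂ ho
  refine ⟨fun w hw => (by cases hw; exact h s₂ ho), fun π => ⟨fun h => (by cases h), ?_⟩⟩
  rintro s₃ T' (⟨h, -⟩ | ⟨t, h⟩) <;> cases h

/-- The environment may run both before and after the action; the hypotheses therefore quantify over
the interference on either side, and stability is left to `vrf_atomic`. -/
theorem after_act {a : Action V A} {Q : A → V.St → Prop} {s : V.St}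
    (he : ∀ s₂, V.osteps s s₂ → ∃ v s₃, a.rel v s₂ s₃)
    (hq : ∀ s₂ v s₃ s₄, V.osteps s s₂ → a.rel v s₂ s₃ → V.osteps s₃ s₄ → Q v s₄) :
    after (.act a) Q s := by
  refine after_coind (fun T s' => T = .act a ∧ s' = s) ?_ ⟨rfl, rfl⟩
  rintro T s' ⟨rfl, rfl⟩ s₂ ho
  refine ⟨fun w hw => (by cases hw), fun π => ⟨fun h => ?_, ?_⟩⟩
  · cases h
    obtain ⟨v, s₃, h⟩ := he s₂ ho
    exact ⟨s₃, .ret v, Or.inr ⟨_, Fire.act a v h⟩⟩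
  · rintro s₃ T' (⟨h, -⟩ | ⟨t, h⟩)
    · cases h
    · cases h with
      | act _ v h => exact Or.inr (after_ret fun s₄ ho' => hq s₂ v s₃ s₄ ho h ho')

/-- As long as the head runs, the sequence mirrors its steps. When the head has become a value, the
intermediate condition holds after whatever interference has occurred, and the continuation takes
over. -/
theorem after_seq {T : ActTree V B} {K : B → ActTree V A} {Q₁ : B → V.St → Prop}
    {Q : A → V.St → Prop} {s : V.St} (hs : V.S s) (h : after T Q₁ s)
    (hK : ∀ v s', V.S s' → Q₁ v s' → after (K v) Q s') : after (.seq T K) Q s := by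
  refine after_coind (fun T' s => ∃ T, T' = .seq T K ∧ V.S s ∧ after T Q₁ s) ?_ ⟨T, rfl, hs, h⟩
  rintro T' s ⟨T, rfl, hs, h⟩ s₂ ho
  have hs₂ := Resource.osteps_S ho hs
  obtain ⟨h₁, h₂⟩ := after_elim h ho
  refine ⟨fun w hw => (by cases hw), fun π => ⟨fun hg => ?_, ?_⟩⟩
  · cases hg with
    | seqRet v => exact ⟨s₂, K v, Or.inl ⟨Admin.seqRet v K, rfl⟩⟩
    | seqStep _ hg =>
      obtain ⟨s₃, T₃, ⟨ha, e⟩ | ⟨t, hf⟩⟩ := (h₂ _).1 hg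
      · exact ⟨s₃, _, Or.inl ⟨Admin.seqStep K ha, e⟩⟩
      · exact ⟨s₃, _, Or.inr ⟨t, Fire.seqStep K hf⟩⟩
  · intro s₃ T' hst
    have hs₃ := hst.preserves hs₂
    rcases hst with ⟨ha, rfl⟩ | ⟨t, hf⟩
    · cases ha with
      | seqRet v => exact Or.inr (hK v _ hs₂ (h₁ v rfl))
      | seqStep _ ha => exact Or.inl ⟨_, rfl, hs₃, (h₂ _).2 _ _ (Or.inl ⟨ha, rfl⟩)⟩
    · cases hf with
      | seqStep _ hf => exact Or.inl ⟨_, rfl, hs₃, (h₂ _).2 _ _ (Or.inr ⟨t, hf⟩)⟩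

/-- Lifting along a family of morphisms, together with a stable predicate `J` that the images of the
transitions preserve. -/
theorem after_morph {f : Family X W V} {x : X} {T : ActTree W A} {Q : A → W.St → Prop}
    {J : V.St → Prop} (hJo : ∀ s s', V.osteps s s' → J s → J s')
    (hJt : ∀ y t s s', (f.tr y t).1 s s' → J s → J s')
    {r : W.St} {s : V.St} (hr : f.rel x r s) (hJ : J s) (h : after T Q r) :
    after (.morph f x T) (fun v s' => J s' ∧ ∃ y r', f.rel y r' s' ∧ Q v r') s := by
  refine after_coind
    (fun T' s => ∃ T y r, T' = .morph f y T ∧ f.rel y r s ∧ J s ∧ after T Q r) ?_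
    ⟨T, x, r, rfl, hr, hJ, h⟩
  rintro T' s ⟨T, y, r, rfl, hr, hJ, h⟩ s₂ ho
  obtain ⟨r₂, ho₂, hr₂⟩ := f.sim_other y r s s₂ ho hr
  have hJ₂ := hJo _ _ ho hJ
  obtain ⟨h₁, h₂⟩ := after_elim h ho₂
  refine ⟨fun w hw => (by cases hw), fun π => ⟨fun hg => ?_, ?_⟩⟩
  · cases hg with
    | morphRet _ _ v => exact ⟨s₂, .ret v, Or.inl ⟨Admin.morphRet f y v, rfl⟩⟩
    | morphStep _ _ hg =>
      obtain ⟨r₃, T₃, ⟨ha, e⟩ | ⟨t, hf⟩⟩ := (h₂ _).1 hg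
      -- Administrative reductions leave both states alone, so no simulation is needed; only a
      -- genuine action must be matched by `sim_int`.
      · exact ⟨s₂, _, Or.inl ⟨Admin.morphStep f y ha, rfl⟩⟩
      · obtain ⟨y', s₃, ht, hr₃⟩ := f.sim_int y t r₂ r₃ s₂ hf.transition hr₂
        exact ⟨s₃, _, Or.inr ⟨_, Fire.morphStep f y y' hr₂ hf hr₃ ht⟩⟩
  · rintro s₃ T' (⟨ha, rfl⟩ | ⟨t, hf⟩)
    · cases ha with
      | morphRet _ _ v =>
        refine Or.inr (after_ret fun s₄ ho' => ?_)
        -- Interference after the return is projected too; appended to the earlier one, it is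
        -- covered by the assumption on the inner tree.
        obtain ⟨r₄, ho₄, hr₄⟩ := f.sim_other y r₂ _ s₄ ho' hr₂
        exact ⟨hJo _ _ ho' hJ₂, y, r₄, hr₄, (after_elim h (ho₂.trans ho₄)).1 v rfl⟩
      | morphStep _ _ ha =>
        exact Or.inl ⟨_, y, r₂, rfl, hr₂, hJ₂, (h₂ _).2 _ _ (Or.inl ⟨ha, rfl⟩)⟩
    · cases hf with
      | morphStep _ _ y' hr₂' hf hr₃ ht =>
        -- The firing rule brings its own inner state; it is the simulated one because the inner
        -- state is a function of the outer.
        obtain rfl := f.functional _ _ _ _ hr₂ hr₂'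
        exact Or.inl ⟨_, y', _, rfl, hr₃, hJt _ _ _ _ ht hJ₂, (h₂ _).2 _ _ (Or.inr ⟨_, hf⟩)⟩

variable {Q : A → V.St → Prop} {s : V.St}

theorem vrf_mono {e : ST V A} {Q' : A → V.St → Prop} (h : vrf e Q s)
    (hQ : ∀ v s', V.S s' → Q v s' → Q' v s') : vrf e Q' s :=
  ⟨h.1, fun T hT => after_mono h.1 (h.2 T hT) hQ⟩

theorem vrf_ret {v : A} (hs : V.S s) (h : ∀ s', V.osteps s s' → Q v s') :
    vrf (ST.ret v) Q s := by
  refine ⟨hs, ?_⟩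
  rintro T (rfl | rfl)
  · exact after_unfinished _ _
  · exact after_ret h

theorem vrf_bind {e₁ : ST V B} {e₂ : B → ST V A} {Q₁ : B → V.St → Prop} (h : vrf e₁ Q₁ s)
    (h₂ : ∀ v s', V.S s' → Q₁ v s' → vrf (e₂ v) Q s') : vrf (e₁.bind e₂) Q s := by
  refine ⟨h.1, ?_⟩
  rintro T (rfl | ⟨T₁, K, rfl, hT, hK⟩)
  · exact after_unfinished _ _
  · exact after_seq h.1 (h.2 T₁ hT) fun v s' hs' hv => (h₂ v s' hs' hv).2 _ (hK v)

/-- The rule for actions: `P` is a stable precondition in which the action is enabled, and `Q` is a stable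
postcondition. -/
theorem vrf_atomic {a : Action V A} {P : V.St → Prop} (hs : V.S s) (hp : P s)
    (hP : ∀ s s', V.S s → V.osteps s s' → P s → P s')
    (hQ : ∀ v s s', V.S s → V.osteps s s' → Q v s → Q v s')
    (he : ∀ s, V.S s → P s → ∃ v s', a.rel v s s')
    (hq : ∀ v s s', V.S s → P s → a.rel v s s' → Q v s') : vrf (ST.atomic a) Q s := by
  refine ⟨hs, ?_⟩
  rintro T (rfl | rfl)
  · exact after_unfinished _ _
  · refine after_act (fun s₂ ho => he s₂ (Resource.osteps_S ho hs) (hP _ _ hs ho hp))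
      fun s₂ v s₃ s₄ ho ht ho' => ?_
    have hs₂ := Resource.osteps_S ho hs
    exact hQ v _ _ ((V.int_trans _ (a.internal v)).1.preserves _ _ ht hs₂) ho'
      (hq v _ _ hs₂ (hP _ _ hs ho hp) ht)

theorem vrf_morph {f : Family X W V} {x : X} {e : ST W A} {Q : A → W.St → Prop}
    {J : V.St → Prop} (hJo : ∀ s s', V.osteps s s' → J s → J s')
    (hJt : ∀ y t s s', (f.tr y t).1 s s' → J s → J s')
    {r : W.St} (hr : f.rel x r s) (hJ : J s) (h : vrf e Q r) :
    vrf (ST.morph f x e) (fun v s' => J s' ∧ ∃ y r', f.rel y r' s' ∧ Q v r') s := by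
  refine ⟨(f.rel_valid _ _ _ hr).2, ?_⟩
  rintro T (rfl | ⟨T₁, hT, rfl⟩)
  · exact after_unfinished _ _
  · exact after_morph hJo hJt hr hJ (h.2 T₁ hT)

/-- The induction rule for recursive programs. -/
theorem vrf_fix {F : ST V A → ST V A} {P : V.St → Prop}
    (hF : ∀ e, (∀ s, V.S s → P s → vrf e Q s) → ∀ s, V.S s → P s → vrf (F e) Q s)
    (hs : V.S s) (hp : P s) : vrf (ST.fix F) Q s := by
  -- The set of all trees that meet the specification is itself a program. By hypothesis it is a
  -- pre-fixed point of `F`, so it contains the least one.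
  let e : ST V A := ⟨{T | ∀ s, V.S s → P s → after T Q s}, fun s _ _ => after_unfinished Q s⟩
  have he : ∀ s, V.S s → P s → vrf e Q s := fun s hs hp => ⟨hs, fun T hT => hT s hs hp⟩
  exact ⟨hs, fun T hT => hT e (fun T' hT' s' hs' hp' => (hF e he s' hs' hp').2 T' hT') s hs hp⟩

end Logic

/-! ### The spin lock on its own -/

section SpinLock

variable {D : Type} {r : ℕ}

/-- Ownership excludes `¬λ`, which rules out locking by others, while their unlocking and setting
would need this thread's share to be `free`. Only idling remains. -/
theorem spin_ostep_owned {s s' : State Own SpinJoint} (hs : (spinSpace D r).S s)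
    (ho : s.self = .own) (h : (spinRes D r).ostep s s') : s' = s := by
  have hl : s.joint.lam = false → False := fun hl => by
    have := (Own.add_eq_free.1 (hs.2.2 hl).1).1
    rw [ho] at this
    cases this
  have hf : s.self = .free → False := fun hf => by
    rw [ho] at hf
    cases hf
  obtain ⟨t, ⟨-, t₀, h₀, G, rfl⟩ | ht, h⟩ := h
  · have h := h.2
    rcases h₀ with rfl | rfl | rfl
    · exact (hl h.2.2.2.1).elim
    · exact (hf h.2.2.2.2.2.1).elim
    · exact congrArg State.transpose h.2
  · rcases ht with rfl | rfl | ⟨b, rfl | rfl⟩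
    · exact (hl h.2.2.2.1).elim
    · exact (hf h.2.2.2.2.2.1).elim
    · exact (hf h.2.2.2.2.2.1).elim
    · exact (hf h.2.2.2.2.2.1).elim

theorem spin_osteps_owned {s s' : State Own SpinJoint} (hs : (spinSpace D r).S s)
    (ho : s.self = .own) (h : (spinRes D r).osteps s s') : s' = s := by
  induction h with
  | refl => rfl
  | tail _ h ih =>
    subst ih
    exact spin_ostep_owned hs ho h

/-- An untaken lock has `μ = free`, so the environment's share is the unit and any defined share may
be acquired. -/
theorem spinLock_enabled {x : Own} {s : State Own SpinJoint} (hx : PCM.defined x)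
    (hs : (spinSpace D r).S s) (hl : s.joint.lam = false) :
    spinLockTr D r x s ⟨x, ⟨true, true⟩, s.other⟩ := by
  refine ⟨hs, ⟨?_, hs.2.1, fun h => by cases h⟩, rfl, hl, rfl, rfl, rfl⟩
  change PCM.defined (x + s.other)
  rw [(Own.add_eq_free.1 (hs.2.2 hl).1).2, Own.add_free]
  exact hx

/-- A failed attempt needs to establish nothing, because the loop has a trivial precondition; hence
the intermediate assertion is conditional on success. -/
theorem vrf_lock {s : State Own SpinJoint} (hs : (spinRes D r).S s) :
    vrf (lock D r) (fun _ s => s.self = Own.own ∧ s.joint.pi = true) s := by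
  refine vrf_fix (P := fun _ => True) ?_ hs trivial
  intro e he s hs _
  refine vrf_bind (Q₁ := fun b s => b = true → s.self = Own.own ∧ s.joint.pi = true) ?_ ?_
  · refine vrf_atomic (P := fun _ => True) hs trivial (fun _ _ _ _ h => h) ?_ ?_ ?_
    · intro b s s' hs ho h hb
      rw [spin_osteps_owned hs (h hb).1 ho]
      exact h hb
    · intro s hs _
      cases hl : s.joint.lam with
      | false => exact ⟨true, _, spinLock_enabled (by intro h; cases h) hs hl⟩
      | true => exact ⟨false, s, hl, hs, rfl⟩
    · rintro b s s' hs - h rfl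
      exact ⟨h.2.2.2.2.2.1, h.2.2.2.2.2.2⟩
  · intro b s' hs' hb
    cases b with
    | false => exact he s' hs' trivial
    | true =>
      refine vrf_ret hs' fun s'' ho => ?_
      rw [spin_osteps_owned hs' (hb rfl).1 ho]
      exact hb rfl

end SpinLock

namespace RW

variable {D : Type} {P : RWParams D} {h : Heap D} {c x : ℕ} {s s' : RWState D}

/-! ### Enabledness -/

section Enabled

variable {a : Rel Own SpinJoint} {b : Rel Unit (SharJoint D)} {c : Rel (Heap D) Unit}
  {d : Rel Own SpinJoint} {e : Rel ℕ Bool} {f : Rel Unit (SharJoint D)}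

/-- Definedness of the total heap implies that of all partial sums which the nested couplings ask
for. This serves the rows that move a heap between components, where the single components do not
keep their pointers. -/
theorem row_intro (hS : (space P).S s) (ha : a s.wrPart s'.wrPart) (hb : b s.sharPart s'.sharPart)
    (hc : c s.privPart s'.privPart) (hd : d s.rdPart s'.rdPart) (he : e s.countPart s'.countPart)
    (hf : f s.sharPart₂ s'.sharPart₂) (hdef : PCM.defined ((space P).flat s')) :
    row P a b c d e f s s' := by
  have right : ∀ a b : Heap D, PCM.defined (a + b) → PCM.defined b := fun a b hab =>
    PCM.defined_left b a (by rwa [add_comm])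
  have h₁ := PCM.defined_left _ _ hdef
  have h₂ := right _ _ hdef
  exact ⟨hS, ⟨hS.1, ⟨hS.1.1, ha, hb, PCM.defined_left _ _ h₁⟩, hc, h₁⟩,
    ⟨hS.2.1, ⟨hS.2.1.1, hd, he, PCM.defined_left _ _ h₂⟩, hf, h₂⟩, hdef⟩

/-- When every component keeps its pointers, disjointness of the new heaps comes for free from that
of the old ones. -/
theorem row_enabled (ta : IsTransition (spinSpace D P.wr) a)
    (tb : IsTransition (sharSpace P.I) b) (tc : IsTransition (privSpace D) c)
    (td : IsTransition (spinSpace D P.rd) d) (te : IsTransition (countSpace D P.ct) e)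
    (tf : IsTransition (sharSpace P.I) f)
    (ia : IsInternal (spinSpace D P.wr) a)
    (ib : IsInternal (sharSpace P.I) b) (ic : IsInternal (privSpace D) c)
    (id' : IsInternal (spinSpace D P.rd) d) (ie : IsInternal (countSpace D P.ct) e)
    (if' : IsInternal (sharSpace P.I) f)
    (hS : (space P).S s) (ha : a s.wrPart s'.wrPart) (hb : b s.sharPart s'.sharPart)
    (hc : c s.privPart s'.privPart) (hd : d s.rdPart s'.rdPart) (he : e s.countPart s'.countPart)
    (hf : f s.sharPart₂ s'.sharPart₂) : row P a b c d e f s s' :=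
  couple_enabled (couple_isTransition (couple_isTransition ta tb) tc)
    (couple_isTransition (couple_isTransition td te) tf)
    (couple_internal (couple_isTransition ta tb) tc (couple_internal ta tb ia ib) ic)
    (couple_internal (couple_isTransition td te) tf (couple_internal td te id' ie) if') hS
    (couple_enabled (couple_isTransition ta tb) tc (couple_internal ta tb ia ib) ic hS.1
      (couple_enabled ta tb ia ib hS.1.1 ha hb) hc)
    (couple_enabled (couple_isTransition td te) tf (couple_internal td te id' ie) if' hS.2.1
      (couple_enabled td te id' ie hS.2.1.1 hd he) hf)

/-- The state with the given components. -/
def ofParts (s₁ : State Own SpinJoint) (s₂ : State Unit (SharJoint D)) (s₃ : State (Heap D) Unit)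
    (s₄ : State Own SpinJoint) (s₅ : State ℕ Bool) (s₆ : State Unit (SharJoint D)) : RWState D :=
  State.pair (State.pair (State.pair s₁ s₂) s₃) (State.pair (State.pair s₄ s₅) s₆)

/-- Together with the two lemmas that follow: if only one component moves, by a transition that
keeps its pointers, its new state is put in place of the old one and all else idles. -/
theorem wr_enabled (hS : (space P).S s) (ho : s.muS₂ = .own) {s₁ : State Own SpinJoint}
    (ta : IsTransition (spinSpace D P.wr) a) (ia : IsInternal (spinSpace D P.wr) a)
    (ha : a s.wrPart s₁) : ∃ s', row P a (sharSkip P) privSkip (rdOwned P) (countSkip P)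
      (sharSkip P) s s' :=
  ⟨ofParts s₁ s.sharPart s.privPart s.rdPart s.countPart s.sharPart₂,
    row_enabled ta (skip_isTransition _) (skip_isTransition _) rdOwned_isTransition
      (skip_isTransition _) (skip_isTransition _) ia (skip_internal _) (skip_internal _)
      rdOwned_internal (skip_internal _) (skip_internal _) hS ha ⟨hS.1.1.2.1, rfl⟩ ⟨hS.1.2.1, rfl⟩
      ⟨ho, hS.2.1.1.1, rfl⟩ ⟨hS.2.1.1.2.1, rfl⟩ ⟨hS.2.1.2.1, rfl⟩⟩

theorem count_enabled (hS : (space P).S s) (ho : s.muS₂ = .own) {s₅ : State ℕ Bool}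
    (te : IsTransition (countSpace D P.ct) e) (ie : IsInternal (countSpace D P.ct) e)
    (he : e s.countPart s₅) : ∃ s', row P (wrSkip P) (sharSkip P) privSkip (rdOwned P) e
      (sharSkip P) s s' :=
  ⟨ofParts s.wrPart s.sharPart s.privPart s.rdPart s₅ s.sharPart₂,
    row_enabled (skip_isTransition _) (skip_isTransition _) (skip_isTransition _)
      rdOwned_isTransition te (skip_isTransition _) (skip_internal _) (skip_internal _)
      (skip_internal _) rdOwned_internal ie (skip_internal _) hS ⟨hS.1.1.1, rfl⟩ ⟨hS.1.1.2.1, rfl⟩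
      ⟨hS.1.2.1, rfl⟩ ⟨ho, hS.2.1.1.1, rfl⟩ he ⟨hS.2.1.2.1, rfl⟩⟩

theorem rd_enabled (hS : (space P).S s) {s₄ : State Own SpinJoint}
    (td : IsTransition (spinSpace D P.rd) d) (id' : IsInternal (spinSpace D P.rd) d)
    (hd : d s.rdPart s₄) : ∃ s', row P (wrSkip P) (sharSkip P) privSkip d (countSkip P)
      (sharSkip P) s s' :=
  ⟨ofParts s.wrPart s.sharPart s.privPart s₄ s.countPart s.sharPart₂,
    row_enabled (skip_isTransition _) (skip_isTransition _) (skip_isTransition _) td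
      (skip_isTransition _) (skip_isTransition _) (skip_internal _) (skip_internal _)
      (skip_internal _) id' (skip_internal _) (skip_internal _) hS ⟨hS.1.1.1, rfl⟩ ⟨hS.1.1.2.1, rfl⟩
      ⟨hS.1.2.1, rfl⟩ hd ⟨hS.2.1.1.2.1, rfl⟩ ⟨hS.2.1.2.1, rfl⟩⟩

end Enabled

/-- The writers lock is held by nobody in particular, and may be released. -/
def Frozen (s : RWState D) : Prop := s.lam = true ∧ s.mu = .free ∧ s.pi = true

theorem freeze_enabled (hS : (space P).S s) (ho : s.muS₂ = .own) (hl : s.lam = false) :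
    ∃ s', freezeTr P s s' :=
  wr_enabled hS ho (spinLock_isTransition _ _) (spin_internal _ _)
    (spinLock_enabled (by intro h; cases h) hS.1.1.1 hl)

/-- The third clause of `Frozen` is the permission to release; the second makes the released lock a
legal state, which must be owned by nobody. -/
theorem unfreeze_enabled (hS : (space P).S s) (ho : s.muS₂ = .own) (hf : Frozen s) :
    ∃ s', unfreezeTr P s s' := by
  obtain ⟨hl, hm, hp⟩ := hf
  obtain ⟨h₁, h₂⟩ := Own.add_eq_free.1 hm
  have hw := hS.1.1.1
  refine wr_enabled (s₁ := ⟨.free, ⟨false, true⟩, s.wrPart.other⟩) hS ho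
    (spinUnlock_isTransition _ _) (spin_internal _ _)
    ⟨hw, ⟨?_, hw.2.1, fun _ => ⟨?_, rfl⟩⟩, rfl, hl, h₁, h₂, hp, rfl⟩
  · rw [h₂]
    intro h
    cases h
  · rw [h₂]
    rfl

/-- Ownership alone gives `λ₂` and that the environment has no share; the permission `π₂` comes from
the invariant. -/
theorem rdunlock_enabled (hS : (space P).S s) (hi : inv s) (ho : s.muS₂ = .own) :
    ∃ s', rdunlockTr P s s' := by
  have hw := hS.2.1.1.1
  have h₂ : s.rdPart.other = .free := by
    have := hw.1
    rwa [show (State.fst (State.fst (State.snd s))).self = .own from ho, Own.own_add_defined] at this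
  have hl : s.rdPart.joint.lam = true := by
    rw [← Bool.not_eq_false]
    intro hl
    have := (Own.add_eq_free.1 (hw.2.2 hl).1).1
    rw [show (State.fst (State.fst (State.snd s))).self = .own from ho] at this
    cases this
  refine rd_enabled (s₄ := ⟨.free, ⟨false, true⟩, s.rdPart.other⟩) hS
    (spinUnlock_isTransition _ _) (spin_internal _ _)
    ⟨hw, ⟨?_, hw.2.1, fun _ => ⟨?_, rfl⟩⟩, rfl, hl, ho, h₂, hi.2.2.1, rfl⟩
  · rw [h₂]
    intro h
    cases h
  · rw [h₂]
    rfl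

theorem incr_enabled (hS : (space P).S s) (ho : s.muS₂ = .own) (hi : s.iota = true) :
    ∃ s', incrTr P s s' :=
  count_enabled (s₅ := ⟨s.countPart.self + 1, s.iota, s.countPart.other⟩) hS ho
    (countIncr_isTransition _) (count_internal _ _)
    ⟨hS.2.1.1.2.1, ⟨hS.2.1.1.2.1.1, fun _ => hi⟩, rfl, hi, rfl⟩

theorem decr_enabled (hS : (space P).S s) (ho : s.muS₂ = .own) (hc : s.kappaS = c + 1) :
    ∃ s', decrTr P s s' :=
  count_enabled (s₅ := ⟨c, true, s.countPart.other⟩) hS ho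
    (countDecr_isTransition _) (count_internal _ _)
    ⟨hS.2.1.1.2.1, ⟨hS.2.1.1.2.1.1, fun _ => rfl⟩, rfl, hc.symm, rfl⟩

/-- The invariant locates the protected heap: `π = ν` puts it with the writers, and the last clause
then leaves the readers' shared heap empty. -/
theorem toreader_enabled (hS : (space P).S s) (hi : inv s) (ho : s.muS₂ = .own) (hf : Frozen s)
    (hk : s.kappa = 0) : ∃ s', toreaderTr P s s' := by
  obtain ⟨hl, hm, hp⟩ := hf
  obtain ⟨h₁, h₂⟩ := Own.add_eq_free.1 hm
  have hn : s.nu = true := hi.1.symm.trans hp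
  have hn₂ : s.nu₂ = false := by
    rw [← Bool.not_eq_true]
    intro h
    have := (hi.2.2.2.2.1 h).2.2
    rw [hn] at this
    cases this
  have hw := hS.1.1.1
  have hs := hS.1.1.2.1
  have hs₂ := hS.2.1.2.1
  have hI : P.I s.sharPart.joint.heap := by
    have := hs.2
    rwa [show (State.snd (State.fst (State.fst s))).joint.nu = true from hn, if_pos rfl] at this
  have he : s.sharPart₂.joint.heap = 0 := by
    have := hs₂.2
    rwa [show (State.snd (State.snd s)).joint.nu = false from hn₂, if_neg (by decide)] at this
  refine ⟨ofParts ⟨.free, ⟨true, false⟩, s.wrPart.other⟩ ⟨(), ⟨0, false⟩, ()⟩ s.privPart s.rdPart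
    ⟨s.countPart.self, true, s.countPart.other⟩ ⟨(), ⟨s.sharPart.joint.heap, true⟩, ()⟩,
    s.sharPart.joint.heap, row_intro hS ?_ ?_ ⟨hS.1.2.1, rfl⟩ ⟨ho, hS.2.1.1.1, rfl⟩ ?_ ?_ ?_⟩
  · refine ⟨hw, ⟨?_, hw.2.1, fun h => by cases h⟩, rfl, hl, h₁, h₂, rfl, rfl, rfl⟩
    have := hw.1
    rwa [show (State.fst (State.fst (State.fst s))).self = .free from h₁] at this
  · exact ⟨hs, ⟨PCM.defined_zero, rfl⟩, rfl, rfl, hn, rfl, rfl⟩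
  · exact ⟨hS.2.1.1.2.1, ⟨hS.2.1.1.2.1.1, fun _ => rfl⟩, rfl, hk, hk, rfl⟩
  · exact ⟨hs₂, ⟨hs.1, hI⟩, rfl, hI, hn₂, rfl, rfl⟩
  · have hd := (space P).flat_valid s hS
    rw [flat_eq, he, show s.wrPart.joint.lam = true from hl, add_zero] at hd
    rw [flat_eq]
    change PCM.defined (((Heap.pts P.wr (.bool true) + 0) +
      (s.privPart.self + s.privPart.other)) + ((Heap.pts P.rd (.bool s.rdPart.joint.lam) +
      Heap.pts P.ct (.nat (s.countPart.self + s.countPart.other))) + s.sharPart.joint.heap))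
    -- The transfer only permutes the summands of the flattened heap: `λ` and `κ` are unchanged,
    -- hence so are their cells.
    convert hd using 1
    abel

/-- The hypothesis is `ι` rather than `Frozen`, since the last reader need not be the thread that
froze the lock. The invariant turns `ι` into `ν₂`, and `ν₂` into `λ`, `μ = free` and `¬ν`. -/
theorem towriter_enabled (hS : (space P).S s) (hi : inv s) (ho : s.muS₂ = .own)
    (hj : s.iota = true) (hk : s.kappa = 0) : ∃ s', towriterTr P s s' := by
  have hn₂ : s.nu₂ = true := hi.2.1.symm.trans hj
  obtain ⟨hl, hm, hn⟩ := hi.2.2.2.2.1 hn₂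
  obtain ⟨h₁, h₂⟩ := Own.add_eq_free.1 hm
  have hw := hS.1.1.1
  have hs := hS.1.1.2.1
  have hs₂ := hS.2.1.2.1
  have hI : P.I s.sharPart₂.joint.heap := by
    have := hs₂.2
    rwa [show (State.snd (State.snd s)).joint.nu = true from hn₂, if_pos rfl] at this
  have he : s.sharPart.joint.heap = 0 := by
    have := hs.2
    rwa [show (State.snd (State.fst (State.fst s))).joint.nu = false from hn,
      if_neg (by decide)] at this
  refine ⟨ofParts ⟨.free, ⟨true, true⟩, s.wrPart.other⟩ ⟨(), ⟨s.sharPart₂.joint.heap, true⟩, ()⟩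
    s.privPart s.rdPart ⟨s.countPart.self, false, s.countPart.other⟩ ⟨(), ⟨0, false⟩, ()⟩,
    s.sharPart₂.joint.heap, row_intro hS ?_ ?_ ⟨hS.1.2.1, rfl⟩ ⟨ho, hS.2.1.1.1, rfl⟩ ?_ ?_ ?_⟩
  · refine ⟨hw, ⟨?_, hw.2.1, fun h => by cases h⟩, rfl, hl, h₁, h₂, rfl, rfl, rfl⟩
    have := hw.1
    rwa [show (State.fst (State.fst (State.fst s))).self = .free from h₁] at this
  · exact ⟨hs, ⟨hs₂.1, hI⟩, rfl, hI, hn, rfl, rfl⟩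
  · refine ⟨hS.2.1.1.2.1, ⟨hS.2.1.1.2.1.1, fun h => ?_⟩, rfl, hk, hk, rfl⟩
    -- Clearing `ι` is legal only because the count is still zero afterwards.
    exact absurd hk (Nat.ne_of_gt h)
  · exact ⟨hs₂, ⟨PCM.defined_zero, rfl⟩, rfl, rfl, hn₂, rfl, rfl⟩
  · have hd := (space P).flat_valid s hS
    rw [flat_eq, he, show s.wrPart.joint.lam = true from hl, add_zero] at hd
    rw [flat_eq]
    change PCM.defined (((Heap.pts P.wr (.bool true) + s.sharPart₂.joint.heap) +
      (s.privPart.self + s.privPart.other)) + ((Heap.pts P.rd (.bool s.rdPart.joint.lam) +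
      Heap.pts P.ct (.nat (s.countPart.self + s.countPart.other))) + 0))
    convert hd using 1
    abel

/-! ### Stability -/

/-- The coupled product has no external transitions, so neither has its restriction; guards may be
forgotten because only the effect of the step matters. -/
theorem ostep_base (h : (rwLock P).ostep s s') :
    ∃ t, Base P t ∧ t s.transpose s'.transpose := by
  obtain ⟨t, ⟨-, t₀, h₀, G, rfl⟩ | ⟨t', ht', -⟩, h⟩ := h
  · exact ⟨t₀, h₀, h.2⟩
  · exact ht'.elim

/-- While a thread holds the readers lock, its environment changes neither the counter nor a writers lock that is
held by nobody in particular. -/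
theorem ostep_owned (hS : (space P).S s) (ho : s.muS₂ = .own) (h : (rwLock P).ostep s s') :
    s'.countPart = s.countPart ∧ (s.lam = true → s.mu = .free → s'.wrPart = s.wrPart) := by
  -- Three reasons for which environment steps are impossible: both threads would own the readers
  -- lock, the writers lock would have to be untaken, or it would have to be owned by the
  -- environment.
  have hx : (RWState.rdPart s.transpose).self = .own → False := by
    intro hx
    have hd := hS.2.1.1.1.1
    rw [show (State.fst (State.fst (State.snd s))).self = .own from ho,
      show (State.fst (State.fst (State.snd s))).other = .own from hx] at hd
    exact hd rfl
  have hl : s.lam = true → (RWState.wrPart s.transpose).joint.lam = false → False :=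
    fun h₁ h₂ => Bool.false_ne_true (h₂.symm.trans h₁)
  have hm : s.mu = .free → (RWState.wrPart s.transpose).self = .own → False := by
    intro h₁ h₂
    have := h₂.symm.trans (Own.add_eq_free.1 h₁).2
    cases this
  have kc : (RWState.countPart s'.transpose) = (RWState.countPart s.transpose) →
      s'.countPart = s.countPart := fun e => congrArg State.transpose e
  have kw : (RWState.wrPart s'.transpose) = (RWState.wrPart s.transpose) →
      s'.wrPart = s.wrPart := fun e => congrArg State.transpose e
  obtain ⟨t, ht, h⟩ := ostep_base h
  cases ht with
  | wrlock =>
    obtain ⟨-, a, -, -, -, e, -⟩ := row_elim h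
    exact ⟨kc e.2, fun h₁ _ => (hl h₁ a.2.2.2.1).elim⟩
  | wrunlock =>
    obtain ⟨-, a, -, -, -, e, -⟩ := row_elim h
    exact ⟨kc e.2, fun _ h₂ => (hm h₂ a.2.2.2.2.1).elim⟩
  | freeze => exact (hx (row_elim h).2.2.2.2.1.1).elim
  | unfreeze => exact (hx (row_elim h).2.2.2.2.1.1).elim
  | rdlock =>
    obtain ⟨-, a, -, -, -, e, -⟩ := row_elim h
    exact ⟨kc e.2, fun _ _ => kw a.2⟩
  | rdunlock =>
    obtain ⟨-, a, -, -, -, e, -⟩ := row_elim h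
    exact ⟨kc e.2, fun _ _ => kw a.2⟩
  | incr => exact (hx (row_elim h).2.2.2.2.1.1).elim
  | decr => exact (hx (row_elim h).2.2.2.2.1.1).elim
  | opening =>
    obtain ⟨k, h⟩ := h
    obtain ⟨-, a, -, -, -, e, -⟩ := row_elim h
    exact ⟨kc e.2, fun _ h₂ => (hm h₂ a.2.2.2.2.1).elim⟩
  | closing k =>
    obtain ⟨-, a, -, -, -, e, -⟩ := row_elim h
    exact ⟨kc e.2, fun _ h₂ => (hm h₂ a.2.2.2.2.1).elim⟩
  | toreader =>
    obtain ⟨k, h⟩ := h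
    exact (hx (row_elim h).2.2.2.2.1.1).elim
  | towriter =>
    obtain ⟨k, h⟩ := h
    exact (hx (row_elim h).2.2.2.2.1.1).elim
  | write p v =>
    obtain ⟨-, a, -, -, -, e, -⟩ := row_elim h
    exact ⟨kc e.2, fun _ _ => kw a.2⟩
  | idle =>
    have e : s' = s := congrArg State.transpose h.2
    subst e
    exact ⟨rfl, fun _ _ => rfl⟩

/-- Ownership lies in self and so persists along the whole run, which makes the one-step statement
applicable each time. -/
theorem osteps_owned (hS : (rwLock P).S s) (ho : s.muS₂ = .own) (h : (rwLock P).osteps s s') :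
    s'.countPart = s.countPart ∧ (s.lam = true → s.mu = .free → s'.wrPart = s.wrPart) := by
  induction h with
  | refl => exact ⟨rfl, fun _ _ => rfl⟩
  | @tail s₁ s₂ h h' ih =>
    have ho₁ : RWState.muS₂ s₁ = .own :=
      (congrArg (fun x => x.2.1.1) (Resource.osteps_self h)).trans ho
    obtain ⟨k₁, k₂⟩ := ostep_owned (Resource.osteps_S h hS).1 ho₁ h'
    refine ⟨k₁.trans ih.1, fun hl hm => ?_⟩
    have e := ih.2 hl hm
    -- The premises on the writers lock were assumed at the start of the run; they carry over
    -- because the component is so far unchanged.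
    refine (k₂ ?_ ?_).trans e
    · exact (congrArg (fun w : State Own SpinJoint => w.joint.lam) e).trans hl
    · exact (congrArg (fun w : State Own SpinJoint => w.self + w.other) e).trans hm

/-- Assertions that are preserved by the environment. -/
def Stable (P : RWParams D) (Q : RWState D → Prop) : Prop :=
  ∀ s s', (rwLock P).S s → (rwLock P).osteps s s' → Q s → Q s'

theorem stable_self : Stable P fun s => s.sigmaS = h ∧ s.kappaS = c := by
  rintro s s' - ho ⟨h₁, h₂⟩
  -- Self is nested as `((wr, shar), priv), ((rd, count), shar)`; the projections pick the private
  -- heap and the count.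
  have e := Resource.osteps_self ho
  exact ⟨(congrArg (fun x => x.1.2) e).trans h₁, (congrArg (fun x => x.2.1.2) e).trans h₂⟩

/-- The thread holds the readers lock, and its private heap and its registrations are given. -/
def Owned (h : Heap D) (c : ℕ) (R : State ℕ Bool → Prop) (s : RWState D) : Prop :=
  s.sigmaS = h ∧ s.kappaS = c ∧ s.muS₂ = .own ∧ R s.countPart

/-- `R` can be arbitrary, even about `κ_o` and `ι`, because under ownership the counter component
does not change at all. -/
theorem stable_owned {R : State ℕ Bool → Prop} : Stable P (Owned h c R) := by
  rintro s s' hS ho ⟨h₁, h₂, h₃, h₄⟩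
  have e := Resource.osteps_self ho
  refine ⟨(congrArg (fun x => x.1.2) e).trans h₁, (congrArg (fun x => x.2.1.2) e).trans h₂,
    (congrArg (fun x => x.2.1.1) e).trans h₃, ?_⟩
  rw [(osteps_owned hS h₃ ho).1]
  exact h₄

/-- Ownership of the readers lock is essential: another reader holding it could unfreeze the writers
lock. -/
theorem Stable.frozen {Q : RWState D → Prop} (hQ : Stable P Q) (ho : ∀ s, Q s → s.muS₂ = .own) :
    Stable P fun s => Q s ∧ Frozen s := by
  rintro s s' hS hos ⟨h₁, h₂⟩
  refine ⟨hQ s s' hS hos h₁, ?_⟩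
  have e := (osteps_owned hS (ho s h₁) hos).2 h₂.1 h₂.2.1
  exact ⟨(congrArg (fun w : State Own SpinJoint => w.joint.lam) e).trans h₂.1,
    (congrArg (fun w : State Own SpinJoint => w.self + w.other) e).trans h₂.2.1,
    (congrArg (fun w : State Own SpinJoint => w.joint.pi) e).trans h₂.2.2⟩

/-! ### Verification -/

section Rows

variable {a : Rel Own SpinJoint} {b f : Rel Unit (SharJoint D)} {e : Rel ℕ Bool}
  {R : State ℕ Bool → Prop}

/-- Common to all transitions that are taken under the readers lock: the private heap idles, and the
guarded idling of the readers lock keeps its owner. -/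
theorem row_owned (ht : row P a b privSkip (rdOwned P) e f s s') (hs : s.sigmaS = h) :
    s'.sigmaS = h ∧ s'.muS₂ = .own := by
  obtain ⟨-, -, -, p, r, -, -⟩ := row_elim ht
  exact ⟨(congrArg State.self p.2).trans hs, (congrArg State.self r.2.2).trans r.1⟩

theorem row_countSkip (ht : row P a b privSkip (rdOwned P) (countSkip P) f s s')
    (hs : Owned h c R s) : Owned h c R s' := by
  obtain ⟨h₁, h₂⟩ := row_owned ht hs.1
  have e := (row_elim ht).2.2.2.2.2.1.2
  refine ⟨h₁, (congrArg State.self e).trans hs.2.1, h₂, ?_⟩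
  rw [e]
  exact hs.2.2.2

end Rows

/-- Serves twice: as preservation of the framed assertion in the lifting of `lock`, and for
`rdunlockTr`, which unfolds to such a lift. -/
theorem rdLift_self {t : Rel Own SpinJoint} (ht : rdLift P t s s')
    (hs : s.sigmaS = h ∧ s.kappaS = c) : s'.sigmaS = h ∧ s'.kappaS = c := by
  obtain ⟨-, -, -, p, -, k, -⟩ := row_elim ht
  exact ⟨(congrArg State.self p.2).trans hs.1, (congrArg State.self k.2).trans hs.2⟩

/-- Lifting is applied twice. The facts about private heap and count live in components that idle
under the inner morphism, and travel in its `J`; the outer morphism is the identity and needs none.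
-/
theorem vrf_rdlock (hS : (rwLock P).S s) (h₁ : s.sigmaS = h) (h₂ : s.kappaS = c) :
    vrf (rdlock P) (fun _ s => RWState.sigmaS s = h ∧ RWState.kappaS s = c ∧
      RWState.muS₂ s = .own) s := by
  refine vrf_mono (vrf_morph (J := fun _ => True) (fun _ _ _ h => h) (fun _ _ _ _ _ h => h)
    (r := s) ⟨rfl, hS⟩ trivial (vrf_morph
      (J := fun s : RWState D => s.sigmaS = h ∧ s.kappaS = c) ?_ ?_ (r := s.rdPart) ⟨rfl, hS.1⟩
      ⟨h₁, h₂⟩ (vrf_lock hS.1.2.1.1.1))) ?_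
  · rintro s s' ho ⟨h₁, h₂⟩
    have e := Resource.osteps_self ho
    exact ⟨(congrArg (fun x => x.1.2) e).trans h₁, (congrArg (fun x => x.2.1.2) e).trans h₂⟩
  · exact fun _ t s s' ht hJ => rdLift_self ht hJ
  -- The permission `π₂` obtained by `lock` is dropped, since the invariant of the resource already
  -- guarantees it.
  · rintro v s' - ⟨-, -, r, ⟨rfl, -⟩, ⟨h₁, h₂⟩, -, r', ⟨rfl, -⟩, h₃, -⟩
    exact ⟨h₁, h₂, h₃⟩

/-- The value read may be recorded as a stable fact because nobody else can alter the counter any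
more. -/
theorem vrf_readcnt {R : State ℕ Bool → Prop} (hS : (rwLock P).S s) (hs : Owned h c R s) :
    vrf (ST.atomic (readcntAct P)) (fun x => Owned h c fun k => R k ∧ x = c + k.other) s := by
  refine vrf_atomic hS hs stable_owned (fun _ => stable_owned) ?_ ?_
  · exact fun s hS _ => ⟨_, s, rfl, hS.1, rfl⟩
  · rintro x s s' - ⟨h₁, h₂, h₃, h₄⟩ ⟨rfl, -, rfl⟩
    exact ⟨h₁, h₂, h₃, h₄, congrArg (· + RWState.kappaO s') h₂⟩

/-- The counter assertion `R` survives arbitrarily many failed attempts, since the readers lock is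
held throughout; so what was learnt from reading the counter is still valid when the loop ends. -/
theorem vrf_freeze {R : State ℕ Bool → Prop} (hS : (rwLock P).S s) (hs : Owned h c R s) :
    vrf (freeze P) (fun _ s => Owned h c R s ∧ Frozen s) s := by
  have hst : Stable P fun s => Owned h c R s ∧ Frozen s := stable_owned.frozen fun _ h => h.2.2.1
  refine vrf_fix (P := Owned h c R) ?_ hS hs
  intro e he s hS hs
  refine vrf_bind (Q₁ := fun b s => Owned h c R s ∧ (b = true → Frozen s)) ?_ ?_
  · refine vrf_atomic hS hs stable_owned ?_ ?_ ?_
    · intro b s s' hS ho hq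
      refine ⟨stable_owned s s' hS ho hq.1, fun hb => (hst s s' hS ho ⟨hq.1, hq.2 hb⟩).2⟩
    · intro s hS hs
      cases hl : RWState.lam s with
      | false =>
        obtain ⟨s', h⟩ := freeze_enabled hS.1 hs.2.2.1 hl
        exact ⟨true, s', h⟩
      | true => exact ⟨false, s, hl, hS.1, rfl⟩
    · intro b s s' hS hs ht
      cases b with
      | false =>
        obtain ⟨-, -, rfl⟩ := ht
        exact ⟨hs, fun h => by cases h⟩
      | true =>
        refine ⟨row_countSkip ht hs, fun _ => ?_⟩
        obtain ⟨-, ⟨w, -, w₁, w₂, w₃, w₄, w₅⟩, -⟩ := row_elim ht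
        refine ⟨w₃, ?_, w₅⟩
        -- Own share: set to `free` by the non-exclusive locking. Environment's share: unchanged,
        -- and `free` because the lock was untaken.
        exact Own.add_eq_free.2 ⟨w₄, w₁.trans (Own.add_eq_free.1 (w.2.2 w₂).1).2⟩
  · intro b s' hS' hb
    cases b with
    | false => exact he s' hS' hb.1
    | true => exact vrf_ret hS' fun s'' ho => hst _ _ hS' ho ⟨hb.1, hb.2 rfl⟩

/-- Here `x = 0` means that the total count is zero, as setting `ι` requires. Since it stays zero
and `κ_o` is fixed, `κ_s` is also unchanged. -/
theorem vrf_toreader (hS : (rwLock P).S s) (hs : Owned h c (fun k => 0 = c + k.other) s)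
    (hf : Frozen s) : vrf (ST.atomic (toreaderAct P))
      (fun _ => Owned h c fun k => 0 = c + k.other ∧ k.joint = true) s := by
  refine vrf_atomic hS ⟨hs, hf⟩ (stable_owned.frozen fun _ h => h.2.2.1)
    (fun _ => stable_owned) ?_ ?_
  · rintro s hS ⟨⟨-, h₂, h₃, h₄⟩, hf⟩
    obtain ⟨s', h⟩ := toreader_enabled hS.1 hS.2 h₃ hf
      ((congrArg (· + RWState.kappaO s) h₂).trans h₄.symm)
    exact ⟨(), s', h⟩
  · rintro _ s s' hS ⟨⟨h₁, h₂, h₃, h₄⟩, -⟩ ⟨k, ht⟩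
    obtain ⟨k₁, k₂⟩ := row_owned ht h₁
    obtain ⟨-, -, -, -, -, ⟨-, -, e, -, e₁, e₂⟩, -⟩ := row_elim ht
    simp only [RWState.kappaS] at h₂
    refine ⟨k₁, ?_, k₂, ?_, e₂⟩
    · simp only [RWState.kappaS]
      omega
    · omega

theorem vrf_acquire (hS : (rwLock P).S s) (hs : Owned h c (fun k => x = c + k.other) s) :
    vrf (acquire P x) (fun _ => Owned h c fun k => x = c + k.other ∧ k.joint = true) s := by
  unfold acquire
  split_ifs with hx
  · subst hx
    exact vrf_bind (vrf_freeze hS hs) fun _ s' hS' h => vrf_toreader hS' h.1 h.2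
  · refine vrf_ret hS fun s' ho => stable_owned s s' hS ho ⟨hs.1, hs.2.1, hs.2.2.1, hs.2.2.2, ?_⟩
    -- A nonzero `x` is a positive count, and the state space of the counter then forces `ι`:
    -- earlier readers have already transferred the heap.
    refine hS.1.2.1.1.2.1.2 ?_
    have h₂ : s.countPart.self = c := hs.2.1
    have h₄ : x = c + s.countPart.other := hs.2.2.2
    change s.countPart.self + s.countPart.other > 0
    omega

/-- `ι` is what enables the increment, and the equation for `x` discharges the test on the counter.
Neither is needed afterwards. -/
theorem vrf_incr (hS : (rwLock P).S s)
    (hs : Owned h c (fun k => x = c + k.other ∧ k.joint = true) s) :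
    vrf (ST.atomic (incrAct P x)) (fun _ => Owned h (c + 1) fun _ => True) s := by
  refine vrf_atomic hS hs stable_owned (fun _ => stable_owned) ?_ ?_
  · rintro s hS ⟨-, h₂, h₃, h₄, h₅⟩
    obtain ⟨s', h⟩ := incr_enabled hS.1 h₃ h₅
    exact ⟨(), s', h₄.trans (congrArg (· + RWState.kappaO s) h₂.symm), h⟩
  · rintro _ s s' - ⟨h₁, h₂, -⟩ ⟨-, ht⟩
    obtain ⟨k₁, k₂⟩ := row_owned ht h₁
    obtain ⟨-, -, -, -, -, ⟨-, -, -, -, e⟩, -⟩ := row_elim ht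
    exact ⟨k₁, e.trans (congrArg (· + 1) h₂), k₂, trivial⟩

/-- The afterstate keeps the equation with `c + 1`, as `x` is the count before the decrement; thus
`x = 1` will mean that no reader is left. That `ι` holds afterwards, even at count zero, is part of
the transition. -/
theorem vrf_decr (hS : (rwLock P).S s) (hs : Owned h (c + 1) (fun k => x = c + 1 + k.other) s) :
    vrf (ST.atomic (decrAct P x))
      (fun _ => Owned h c fun k => x = c + 1 + k.other ∧ k.joint = true) s := by
  refine vrf_atomic hS hs stable_owned (fun _ => stable_owned) ?_ ?_
  · rintro s hS ⟨-, h₂, h₃, h₄⟩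
    obtain ⟨s', h⟩ := decr_enabled hS.1 h₃ h₂
    exact ⟨(), s', h₄.trans (congrArg (· + RWState.kappaO s) h₂.symm), h⟩
  · rintro _ s s' - ⟨h₁, h₂, -, h₄⟩ ⟨-, ht⟩
    obtain ⟨k₁, k₂⟩ := row_owned ht h₁
    obtain ⟨-, -, -, -, -, ⟨-, -, e, e₁, e₂⟩, -⟩ := row_elim ht
    refine ⟨k₁, Nat.succ.inj (e₁.trans h₂), k₂, ?_, e₂⟩
    rw [e]
    exact h₄

/-- The equation forces both `c` and `κ_o` to vanish. The transition itself leaves the lock frozen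
with permission to release, which is what unfreezing asks for. -/
theorem vrf_towriter (hS : (rwLock P).S s)
    (hs : Owned h c (fun k => 1 = c + 1 + k.other ∧ k.joint = true) s) :
    vrf (ST.atomic (towriterAct P)) (fun _ s => Owned h c (fun _ => True) s ∧ Frozen s) s := by
  refine vrf_atomic hS hs stable_owned (fun _ => stable_owned.frozen fun _ h => h.2.2.1) ?_ ?_
  · rintro s hS ⟨-, h₂, h₃, h₄, h₅⟩
    have hk : RWState.kappa s = 0 := by
      simp only [RWState.kappaS, RWState.kappa] at h₂ ⊢
      omega
    obtain ⟨s', h⟩ := towriter_enabled hS.1 hS.2 h₃ h₅ hk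
    exact ⟨(), s', h⟩
  · rintro _ s s' hS ⟨h₁, h₂, h₃, h₄, -⟩ ⟨k, ht⟩
    obtain ⟨k₁, k₂⟩ := row_owned ht h₁
    obtain ⟨-, ⟨-, -, w, -, -, w₁, w₂, w₃, w₄⟩, -, -, -, ⟨-, -, -, -, e, -⟩, -⟩ := row_elim ht
    simp only [RWState.kappaS] at h₂
    refine ⟨⟨k₁, ?_, k₂, trivial⟩, w₂, Own.add_eq_free.2 ⟨w₃, w.trans w₁⟩, w₄⟩
    simp only [RWState.kappaS]
    omega

theorem vrf_unfreeze {R : State ℕ Bool → Prop} (hS : (rwLock P).S s) (hs : Owned h c R s)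
    (hf : Frozen s) : vrf (ST.atomic (unfreezeAct P)) (fun _ => Owned h c R) s := by
  refine vrf_atomic hS ⟨hs, hf⟩ (stable_owned.frozen fun _ h => h.2.2.1)
    (fun _ => stable_owned) ?_ ?_
  · rintro s hS ⟨hs, hf⟩
    obtain ⟨s', h⟩ := unfreeze_enabled hS.1 hs.2.2.1 hf
    exact ⟨(), s', h⟩
  · rintro _ s s' - ⟨hs, -⟩ ht
    exact row_countSkip ht hs

/-- If other readers remain, nothing is to be transferred; the facts on `x` and `ι` matter only to
the last reader. -/
theorem vrf_release (hS : (rwLock P).S s)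
    (hs : Owned h c (fun k => x = c + 1 + k.other ∧ k.joint = true) s) :
    vrf (release P x) (fun _ => Owned h c fun _ => True) s := by
  unfold release
  split_ifs with hx
  · subst hx
    exact vrf_bind (vrf_towriter hS hs) fun _ s' hS' h => vrf_unfreeze hS' h.1 h.2
  · exact vrf_ret hS fun s' ho => stable_owned s s' hS ho ⟨hs.1, hs.2.1, hs.2.2.1, trivial⟩

/-- Once the lock is given up, only assertions about self remain stable, so the postcondition can no
longer mention the environment's registrations. -/
theorem vrf_rdunlock (hS : (rwLock P).S s) (hs : Owned h c (fun _ => True) s) :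
    vrf (ST.atomic (rdunlockAct P)) (fun _ s => RWState.sigmaS s = h ∧ RWState.kappaS s = c) s := by
  refine vrf_atomic hS hs stable_owned (fun _ => stable_self) ?_ ?_
  · rintro s hS hs
    obtain ⟨s', h⟩ := rdunlock_enabled hS.1 hS.2 hs.2.2.1
    exact ⟨(), s', h⟩
  · rintro _ s s' - hs ht
    exact rdLift_self ht ⟨hs.1, hs.2.1⟩

theorem vrf_prologue (hS : (rwLock P).S s) (h₁ : s.sigmaS = h) (h₂ : s.kappaS = c) :
    vrf (prologue P) (fun _ s => RWState.sigmaS s = h ∧ RWState.kappaS s = c + 1) s := by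
  refine vrf_bind (vrf_rdlock hS h₁ h₂) fun _ s hS hs => ?_
  refine vrf_bind (vrf_readcnt (R := fun _ => True) hS ⟨hs.1, hs.2.1, hs.2.2, trivial⟩)
    fun x s hS hs => ?_
  refine vrf_bind (vrf_acquire hS ⟨hs.1, hs.2.1, hs.2.2.1, hs.2.2.2.2⟩) fun _ s hS hs => ?_
  exact vrf_bind (vrf_incr hS hs) fun _ s hS hs => vrf_rdunlock hS hs

theorem vrf_epilogue (hS : (rwLock P).S s) (h₁ : s.sigmaS = h) (h₂ : s.kappaS = c + 1) :
    vrf (epilogue P) (fun _ s => RWState.sigmaS s = h ∧ RWState.kappaS s = c) s := by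
  refine vrf_bind (vrf_rdlock hS h₁ h₂) fun _ s hS hs => ?_
  refine vrf_bind (vrf_readcnt (R := fun _ => True) hS ⟨hs.1, hs.2.1, hs.2.2, trivial⟩)
    fun x s hS hs => ?_
  refine vrf_bind (vrf_decr hS ⟨hs.1, hs.2.1, hs.2.2.1, hs.2.2.2.2⟩) fun _ s hS hs => ?_
  exact vrf_bind (vrf_release hS hs) fun _ s hS hs => vrf_rdunlock hS hs

end RW

end FCSL

theorem mainTheorem2 {D : Type} (P : FCSL.RWParams D) :
    -- the types of the two procedures
    (FCSL.RW.prologue P ∈ FCSL.HoareType (FCSL.RW.rwLock P)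
      (fun (g : FCSL.Heap D × ℕ) s => FCSL.RWState.sigmaS s = g.1 ∧ FCSL.RWState.kappaS s = g.2)
      (fun g _ s => FCSL.RWState.sigmaS s = g.1 ∧ FCSL.RWState.kappaS s = g.2 + 1)) ∧
    (FCSL.RW.epilogue P ∈ FCSL.HoareType (FCSL.RW.rwLock P)
      (fun (g : FCSL.Heap D × ℕ) s => FCSL.RWState.sigmaS s = g.1 ∧ FCSL.RWState.kappaS s = g.2 + 1)
      (fun g _ s => FCSL.RWState.sigmaS s = g.1 ∧ FCSL.RWState.kappaS s = g.2)) ∧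
    -- the lines of the proof outline of the first procedure
    (FCSL.RW.rdlock P ∈ FCSL.HoareType (FCSL.RW.rwLock P)
      (fun (g : FCSL.Heap D × ℕ) s => FCSL.RWState.sigmaS s = g.1 ∧ FCSL.RWState.kappaS s = g.2)
      (fun g _ s => FCSL.RWState.sigmaS s = g.1 ∧ FCSL.RWState.kappaS s = g.2 ∧
        FCSL.RWState.muS₂ s = FCSL.Own.own)) ∧
    (FCSL.ST.atomic (FCSL.RW.readcntAct P) ∈ FCSL.HoareType (FCSL.RW.rwLock P)
      (fun (g : FCSL.Heap D × ℕ) s => FCSL.RWState.sigmaS s = g.1 ∧ FCSL.RWState.kappaS s = g.2 ∧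
        FCSL.RWState.muS₂ s = FCSL.Own.own)
      (fun g x s => FCSL.RWState.sigmaS s = g.1 ∧ FCSL.RWState.kappaS s = g.2 ∧
        FCSL.RWState.muS₂ s = FCSL.Own.own ∧ x = g.2 + FCSL.RWState.kappaO s)) ∧
    (∀ x : ℕ, FCSL.RW.acquire P x ∈ FCSL.HoareType (FCSL.RW.rwLock P)
      (fun (g : FCSL.Heap D × ℕ) s => FCSL.RWState.sigmaS s = g.1 ∧ FCSL.RWState.kappaS s = g.2 ∧
        FCSL.RWState.muS₂ s = FCSL.Own.own ∧ x = g.2 + FCSL.RWState.kappaO s)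
      (fun g _ s => FCSL.RWState.sigmaS s = g.1 ∧ FCSL.RWState.kappaS s = g.2 ∧
        FCSL.RWState.muS₂ s = FCSL.Own.own ∧ x = g.2 + FCSL.RWState.kappaO s ∧
        FCSL.RWState.iota s = true)) ∧
    (∀ x : ℕ, FCSL.ST.atomic (FCSL.RW.incrAct P x) ∈ FCSL.HoareType (FCSL.RW.rwLock P)
      (fun (g : FCSL.Heap D × ℕ) s => FCSL.RWState.sigmaS s = g.1 ∧ FCSL.RWState.kappaS s = g.2 ∧
        FCSL.RWState.muS₂ s = FCSL.Own.own ∧ x = g.2 + FCSL.RWState.kappaO s ∧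
        FCSL.RWState.iota s = true)
      (fun g _ s => FCSL.RWState.sigmaS s = g.1 ∧ FCSL.RWState.kappaS s = g.2 + 1 ∧
        FCSL.RWState.muS₂ s = FCSL.Own.own)) ∧
    (FCSL.ST.atomic (FCSL.RW.rdunlockAct P) ∈ FCSL.HoareType (FCSL.RW.rwLock P)
      (fun (g : FCSL.Heap D × ℕ) s => FCSL.RWState.sigmaS s = g.1 ∧
        FCSL.RWState.kappaS s = g.2 + 1 ∧ FCSL.RWState.muS₂ s = FCSL.Own.own)
      (fun g _ s => FCSL.RWState.sigmaS s = g.1 ∧ FCSL.RWState.kappaS s = g.2 + 1)) ∧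
    -- the procedure for the spin lock, of which the locking of the readers lock is the lifting
    (FCSL.lock D P.rd ∈ FCSL.HoareType (FCSL.spinRes D P.rd) (fun (_ : Unit) _ => True)
      (fun _ _ s => s.self = FCSL.Own.own ∧ s.joint.pi = true)) ∧
    FCSL.RW.rdlock P =
      FCSL.ST.morph (FCSL.restrictMorphism (FCSL.RW.preRWLock P) FCSL.RW.inv FCSL.RW.inv_global
        FCSL.RW.inv_inductive) () (FCSL.ST.morph (FCSL.RW.rdMorphism P) () (FCSL.lock D P.rd)) := by
  refine ⟨fun g s hS hp => FCSL.RW.vrf_prologue hS hp.1 hp.2,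
    fun g s hS hp => FCSL.RW.vrf_epilogue hS hp.1 hp.2,
    fun g s hS hp => FCSL.RW.vrf_rdlock hS hp.1 hp.2, fun g s hS hp => ?_,
    fun x g s hS hp => FCSL.RW.vrf_acquire hS hp, fun x g s hS hp => ?_,
    fun g s hS hp => FCSL.RW.vrf_rdunlock hS ⟨hp.1, hp.2.1, hp.2.2, trivial⟩,
    fun _ s hS _ => FCSL.vrf_lock hS, rfl⟩
  · exact FCSL.vrf_mono
      (FCSL.RW.vrf_readcnt (R := fun _ => True) hS ⟨hp.1, hp.2.1, hp.2.2, trivial⟩)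
      fun x s' _ h => ⟨h.1, h.2.1, h.2.2.1, h.2.2.2.2⟩
  · exact FCSL.vrf_mono (FCSL.RW.vrf_incr hS hp) fun _ s' _ h => ⟨h.1, h.2.1, h.2.2.1⟩
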